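/- **Model.** Let $T$ be a finite tree whose edges have positive real lengths and in which the edges at each node $v$ carry the port numbers $1,\dots,\deg v$. Let $A$ be a nonempty set of nodes of $T$ that contains all leaves. At time $0$ one agent is placed at each node of $A$, and each agent holds its own piece of initial information. Agents move continuously along edges at unit speed and may stop anywhere; the *power* used by an agent is the distance it travels. Agents meet at a node or inside an edge, and agents that are at the same point exchange all information they hold. *Convergecast* is achieved when some agent holds the initial information of all agents. Let $$D(T,A)=\max_{\emptyset\subsetneq X\subsetneq A}\ \min_{x\in X,\ y\in A\setminus X} d_T(x,y)$$ (with $D(T,A)=0$ if $|A|=1$), where $d_T$ is the weighted distance, and let $P^c_{OPT}(T,A)$ be the infimum of the numbers $P$ for which some centralized strategy (a finite sequence of movements of the agents, each at unit speed between two points of one edge) achieves convergecast with every agent using power at most $P$. In a *distributed algorithm* all agents are anonymous, start simultaneously in the same memory state, and execute the same deterministic program without knowledge of $T$, of the port numbering, of $A$ or of their position. An agent perceives only: the degree of the node at which it is (or that it is inside an edge), the last port through which it entered a node, the power it has used so far, and, for the other agents at its current point, their last entry ports, used power and memory. From this it decides whether to stay, to leave through some port, or, inside an edge, to proceed or turn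 back, possibly only up to a chosen distance; it decides anew whenever it reaches a node, has travelled the chosen distance, or some agents meet at its point. **Theorem.** There is a single distributed algorithm such that, for every such $T$ (with every port numbering) and every such $A$, its execution reaches after finitely many events a configuration in which all agents have stopped for good and some agent holds the initial information of all agents, and in which every agent has used power at most $D(T,A)$. Moreover every agent has used power at most $2P^c_{OPT}(T,A)$; that is, the algorithm is a $2$-competitive convergecast algorithm. -/

import Mathlib

open scoped ENNReal
open scoped Classical

noncomputable section

namespace Convergecast

/-! ### Weighted networks -/

/-- A weighted graph in which the edges at every node `v` carry the port numbers `1, …, deg v`. -/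
structure Network (V : Type*) where
  /-- the underlying graph -/
  G : SimpleGraph V
  /-- the lengths of the edges -/
  len : Sym2 V → ℝ
  len_pos : ∀ e ∈ G.edgeSet, 0 < len e
  /-- `port v u` is the number that the edge from `v` to its neighbour `u` has at `v` -/
  port : V → V → ℕ
  port_bij : ∀ v, Set.BijOn (port v) (G.neighborSet v) (Set.Icc 1 (G.neighborSet v).ncard)

namespace Network

variable {V : Type*} (N : Network V)

/-- The degree of a node. -/
def deg (v : V) : ℕ := (N.G.neighborSet v).ncard

/-- The distance between two nodes: the least length of a walk joining them. -/
def dist (u v : V) : ℝ := ⨅ p : N.G.Walk u v, (p.edges.map N.len).sum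

/-- `D(G, A)`: the maximum, over the splittings of `A` into nonempty parts `X` and `A \ X`, of the
least distance between a node of `X` and a node of `A \ X` (it is `0` if `A` cannot be split). -/
def D (A : Finset V) : ℝ :=
  ⨆ X : {X : Set V // X.Nonempty ∧ X ⊂ (A : Set V)},
    ⨅ q : (X.1 : Set V) × ((A : Set V) \ X.1 : Set V), N.dist q.1 q.2

/-- The points of the network, as points of the geometric realization of the graph, written in
barycentric coordinates: `place u v x` is the point at distance `x` from `u` on the edge `uv`.
Thus `place u v x = place v u (len uv - x)`. -/
def place (u v : V) (x : ℝ) : V → ℝ := fun z =>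
  (if z = u then 1 - x / N.len s(u, v) else 0) + (if z = v then x / N.len s(u, v) else 0)

end Network

/-- The node `v` as a point of the network. -/
def nodePoint {V : Type*} (v : V) : V → ℝ := fun z => if z = v then 1 else 0

/-! ### Centralized strategies -/

/-- A movement at unit speed inside the edge joining `src` and `tgt`, in the direction of `tgt`: it
begins at time `start` at distance `x` from `src` and ends at distance `y` from `src`. -/
structure Movement (V : Type*) where
  src : V
  tgt : V
  start : ℝ
  x : ℝ
  y : ℝ

/-- The power used by a list of movements: the distance travelled. -/
def planPower {V : Type*} (ms : List (Movement V)) : ℝ := (ms.map fun m => m.y - m.x).sum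

namespace Network

variable {V : Type*} (N : Network V)

/-- The movements in the list can be executed in this order by an agent that is at the point `p` at
time `t`. -/
def IsPlan : (V → ℝ) → ℝ → List (Movement V) → Prop
  | _, _, [] => True
  | p, t, m :: ms =>
      t ≤ m.start ∧ N.G.Adj m.src m.tgt ∧
      0 ≤ m.x ∧ m.x ≤ m.y ∧ m.y ≤ N.len s(m.src, m.tgt) ∧
      N.place m.src m.tgt m.x = p ∧
      IsPlan (N.place m.src m.tgt m.y) (m.start + (m.y - m.x)) ms

/-- The position at time `t` of an agent that starts at `p` and executes the movements. -/
def planPos : (V → ℝ) → List (Movement V) → ℝ → V → ℝ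
  | p, [], _ => p
  | p, m :: ms, t =>
      if t < m.start then p
      else if t ≤ m.start + (m.y - m.x) then N.place m.src m.tgt (m.x + (t - m.start))
      else planPos (N.place m.src m.tgt m.y) ms t

end Network

/-- `Informed pos b a t`: when the agents `i` move along the trajectories `pos i` from time `0` on
and exchange all that they hold whenever they meet, at time `t` agent `a` has the initial
information of agent `b`. -/
inductive Informed {I P : Type*} (pos : I → ℝ → P) (b : I) : I → ℝ → Prop
  | own : Informed pos b b 0
  | keep {a : I} {s t : ℝ} : Informed pos b a s → s ≤ t → Informed pos b a t
  | meet {a c : I} {t : ℝ} : Informed pos b a t → pos a t = pos c t → Informed pos b c t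

namespace Network

variable {V : Type*} (N : Network V)

/-- There is a centralized strategy (finitely many movements for every agent; the agents start at
the nodes of `A`) that achieves convergecast and in which every agent uses power at most `P`. -/
def CentralizedConvergecast (A : Finset V) (P : ℝ) : Prop :=
  ∃ plan : A → List (Movement V),
    (∀ a, N.IsPlan (nodePoint a.1) 0 (plan a)) ∧
    (∀ a, planPower (plan a) ≤ P) ∧
    ∃ (a : A) (t : ℝ), ∀ b : A, Informed (fun i => N.planPos (nodePoint i.1) (plan i)) b a t

/-- The optimal power for centralized convergecast (`⊤` if no power suffices). -/
def optimalPower (A : Finset V) : ℝ≥0∞ :=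
  ⨅ (P : ℝ) (_ : N.CentralizedConvergecast A P), ENNReal.ofReal P

end Network

/-! ### Distributed algorithms -/

/-- What an agent decides to do until it is activated again. The number `limit` bounds the distance
that it is willing to travel before it is activated again (`⊤`: no bound). -/
inductive Action
  /-- remain at the present point -/
  | stay
  /-- at a node: leave through the port `p` -/
  | leave (p : ℕ) (limit : ℝ≥0∞)
  /-- inside an edge: proceed in the direction that the agent faces -/
  | forward (limit : ℝ≥0∞)
  /-- inside an edge: turn round and proceed in the other direction -/
  | back (limit : ℝ≥0∞)

/-- What agents at the same point learn about each other: the last entry port (`none` as long as the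
agent has not entered a node), the power used so far, and the whole memory. -/
structure View (S : Type) where
  entry : Option ℕ
  used : ℝ
  memory : S

/-- A deterministic distributed algorithm. All agents execute the same `act` and start with the same
memory. The arguments of `act` are: the degree of the node at which the agent is (`none` if it is
inside an edge), its own view, and the views of the other agents at the same point. -/
structure Algorithm where
  Memory : Type
  init : Memory
  act : Option ℕ → View Memory → Multiset (View Memory) → Memory × Action

/-- Where an agent is: at a node, or on the edge `uv` at distance `x` from `u` and facing `v`. -/
inductive Loc (V : Type*)
  | node (v : V)
  | edge (u v : V) (x : ℝ)

/-- The state of an agent. The agent moves exactly if `ahead ≠ 0`. The set `known` of the agents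
whose initial information it holds is bookkeeping that the algorithm cannot read. -/
structure AgentState (V I : Type*) (S : Type) where
  loc : Loc V
  /-- the distance after which the agent wants to be activated -/
  ahead : ℝ≥0∞
  view : View S
  known : Set I

/-- A global configuration: the state of every agent; `I` is the set of agents. -/
abbrev Config (V I : Type*) (S : Type) := I → AgentState V I S

namespace Network

variable {V I : Type*} {S : Type} (N : Network V)

/-- A location as a point of the network. -/
def point : Loc V → V → ℝ
  | .node v => nodePoint v
  | .edge u v x => N.place u v x

/-- Two agents are at the same point. -/
def Together (C : Config V I S) (a b : I) : Prop := N.point (C a).loc = N.point (C b).loc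

/-- What an agent senses about its location: the degree if it is at a node. -/
def sense : Loc V → Option ℕ
  | .node v => some (N.deg v)
  | .edge _ _ _ => none

/-- The location and the value of `ahead` after an action has been chosen. An action that makes no
sense at the present location amounts to staying. -/
def execute : Loc V → Action → Loc V × ℝ≥0∞
  | .node v, .leave p limit =>
      if h : limit ≠ 0 ∧ ∃ u, N.G.Adj v u ∧ N.port v u = p then (.edge v h.2.choose 0, limit)
      else (.node v, 0)
  | .edge u v x, .forward limit => (.edge u v x, limit)
  | .edge u v x, .back limit => (.edge v u (N.len s(u, v) - x), limit)
  | l, _ => (l, 0)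

/-- An agent's state after time `δ`, if nothing happens in between: a moving agent proceeds at unit
speed, and stops when it reaches the end of the edge. -/
def advanceAgent (δ : ℝ) (s : AgentState V I S) : AgentState V I S :=
  if s.ahead = 0 then s else
  match s.loc with
  | .node _ => s
  | .edge u v x =>
      if N.len s(u, v) ≤ x + δ then
        { s with
          loc := .node v
          ahead := s.ahead - ENNReal.ofReal δ
          view := { s.view with entry := some (N.port v u), used := s.view.used + δ } }
      else
        { s with
          loc := .edge u v (x + δ)
          ahead := s.ahead - ENNReal.ofReal δ
          view := { s.view with used := s.view.used + δ } }

/-- The configuration after time `δ`, if nothing happens in between. -/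
def advance (δ : ℝ) (C : Config V I S) : Config V I S := fun a => N.advanceAgent δ (C a)

/-- After time `δ` something happens to agent `a`: it moves and has reached a node or travelled the
distance that it wanted, or it meets another agent. -/
def Happens (C : Config V I S) (δ : ℝ) (a : I) : Prop :=
  ((C a).ahead ≠ 0 ∧
    ((∃ v, (N.advance δ C a).loc = .node v) ∨ (N.advance δ C a).ahead = 0)) ∨
  ∃ b, ¬ N.Together C a b ∧ N.Together (N.advance δ C) a b

/-- The positive times after which something happens; the first one matters. -/
def eventTimes (C : Config V I S) : Set ℝ := {δ | 0 < δ ∧ ∃ a, N.Happens C δ a}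

/-- All agents at a common point exchange all that they hold, and the agents in `W` are activated:
each of them chooses, by the algorithm, its new memory and its next action. -/
def activate [Fintype I] (alg : Algorithm) (W : Set I) (C : Config V I alg.Memory) :
    Config V I alg.Memory := fun a =>
  let known : Set I := {i | ∃ b, N.Together C a b ∧ i ∈ (C b).known}
  if a ∈ W then
    let others := (Finset.univ.filter fun b => b ≠ a ∧ N.Together C a b).val.map fun b => (C b).view
    let r := alg.act (N.sense (C a).loc) (C a).view others
    let e := N.execute (C a).loc r.2
    { loc := e.1, ahead := e.2, view := { (C a).view with memory := r.1 }, known := known }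
  else { C a with known := known }

/-- Proceed to the next time at which something happens, and activate every agent that then is at a
point where something happens. -/
def step [Fintype I] (alg : Algorithm) (C : Config V I alg.Memory) : Config V I alg.Memory :=
  if (N.eventTimes C).Nonempty then
    let δ := sInf (N.eventTimes C)
    let C' := N.advance δ C
    N.activate alg {a | ∃ b, N.Together C' a b ∧ N.Happens C δ b} C'
  else C

/-- The configuration at time `0`: one agent at every node of `A`, all of them activated. -/
def start (alg : Algorithm) (A : Finset V) : Config V A alg.Memory :=
  N.activate alg Set.univ fun a =>
    { loc := .node a.1, ahead := 0, view := ⟨none, 0, alg.init⟩, known := {a} }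

/-- The configuration after `n` events in the execution of the algorithm by the agents at `A`. -/
def run (alg : Algorithm) (A : Finset V) (n : ℕ) : Config V A alg.Memory :=
  (N.step alg)^[n] (N.start alg A)

end Network

end Convergecast

end

/-! Lower bound. For every splitting of `A`, a convergecast with power `P` lets some agent from one
part meet an agent from the other, since otherwise no information would pass between the parts.
Neither agent has moved farther than `P`, so their starting nodes are at distance at most `2 * P`;
hence `D ≤ 2 * P` (`CentralizedConvergecast.exists_dist_le`, `ofReal_D_le`).

Upper bound. Under `greedy` a node is left once, towards the only neighbour from which nobody has
arrived, by the agent there that has used the least power. By induction this agent knows everything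
behind it and has used at most its distance to each node of `A` behind it. Every edge splits `A`,
because leaves belong to `A`. Some pair across this splitting is at distance at most `D`, and its
path contains the whole edge, so the agent reaches the end of the edge within power `D`
(`exists_pair_dist_le_D`).

Termination. Every event completes the traversal of a new dart or stops agents inside an edge, and
nothing of this is undone (`Inv.step`). If agents have met inside an edge, they know both sides of
it. Otherwise a walk in a finite tree that never turns back has to end, which yields a node that was
never left and was reached from all its neighbours (`Inv.exists_known`).

The induction alternates between `Inv`, valid after an event, and `Pre`, valid just before the
activation (`Inv.advance_pre`, `Pre.activate_inv`). -/

noncomputable section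

namespace Convergecast

/-! ### Sides of an edge and walks without turning back in a tree. -/

section Tree

variable {V : Type*} {G : SimpleGraph V}

/-- The node `x` lies on the side of `v` of the edge `vu`. -/
def Side (G : SimpleGraph V) (v u x : V) : Prop := G.dist x v < G.dist x u

/-- Each such neighbour is the second node of a shortest path from `y` to `r`, and paths in a tree
are unique. -/
theorem tree_parent_unique (hG : G.IsTree) {r y x x' : V} (h : G.Adj y x) (h' : G.Adj y x')
    (hx : G.dist x r < G.dist y r) (hx' : G.dist x' r < G.dist y r) : x = x' := by
  have key : ∀ z, G.Adj y z → G.dist z r < G.dist y r →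
      ∃ p : G.Walk y r, p.IsPath ∧ p.snd = z := by
    intro z hz hzr
    obtain ⟨p, hp, hl⟩ := hG.connected.exists_path_of_dist z r
    refine ⟨.cons hz p, ?_, by simp⟩
    apply SimpleGraph.Walk.isPath_of_length_eq_dist
    have := hG.dist_eq_dist_add_one_of_adj r hz
    rw [G.dist_comm (u := r), G.dist_comm (u := r) (v := z)] at this
    simp only [SimpleGraph.Walk.length_cons]
    omega
  obtain ⟨p, hp, rfl⟩ := key x h hx
  obtain ⟨q, hq, rfl⟩ := key x' h' hx'
  rw [(hG.existsUnique_path y r).unique hp hq]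

theorem exists_adj_closer (hG : G.IsTree) {x v : V} (h : x ≠ v) :
    ∃ w, G.Adj w v ∧ Side G w v x := by
  obtain ⟨p, hp, hl⟩ := hG.connected.exists_path_of_dist v x
  cases p with
  | nil => exact absurd rfl h
  | cons hw q =>
    refine ⟨_, hw.symm, ?_⟩
    have := G.dist_le q
    simp only [SimpleGraph.Walk.length_cons] at hl
    unfold Side
    rw [G.dist_comm, G.dist_comm (v := v)]
    omega

theorem side_or (hG : G.IsTree) {v u : V} (h : G.Adj v u) (x : V) :
    Side G v u x ∨ Side G u v x := by
  have := hG.dist_ne_of_adj x h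
  unfold Side
  omega

theorem Side.not_side {v u x : V} (h : Side G v u x) : ¬ Side G u v x := by
  unfold Side at *
  omega

theorem side_self {v u : V} (h : G.Adj v u) : Side G v u v := by
  simp [Side, SimpleGraph.dist_eq_one_iff_adj.2 h]

theorem Side.exists_adj (hG : G.IsTree) {v u x : V} (h : Side G v u x) (hx : x ≠ v) :
    ∃ w, G.Adj w v ∧ w ≠ u ∧ Side G w v x := by
  obtain ⟨w, hw, hs⟩ := exists_adj_closer hG hx
  refine ⟨w, hw, ?_, hs⟩
  rintro rfl
  exact h.not_side hs

theorem side_crossing (hG : G.IsTree) {v u x y : V} (hvu : G.Adj v u) (hxy : G.Adj x y)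
    (hx : Side G v u x) (hy : Side G u v y) : x = v ∧ y = u := by
  have d1 := hG.dist_eq_dist_add_one_of_adj x hvu
  have d2 := hG.dist_eq_dist_add_one_of_adj y hvu
  have d3 := hG.dist_eq_dist_add_one_of_adj v hxy
  have d4 := hG.dist_eq_dist_add_one_of_adj u hxy
  unfold Side at *
  rw [G.dist_comm (u := v), G.dist_comm (u := v) (v := y)] at d3
  rw [G.dist_comm (u := u), G.dist_comm (u := u) (v := y)] at d4
  -- If `y ≠ u`, the neighbour `y'` of `y` towards `u` is also nearer to `v` than `y`, as is `x`. So
  -- `x = y'`, which contradicts the distances to `u`.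
  have hyu : y = u := by
    by_contra hne
    obtain ⟨y', hy', hs⟩ := exists_adj_closer hG (Ne.symm hne)
    unfold Side at hs
    rw [G.dist_comm, G.dist_comm (v := y)] at hs
    have e1 := hG.dist_eq_dist_add_one_of_adj v hy'
    rw [G.dist_comm (u := v), G.dist_comm (u := v) (v := y)] at e1
    have e2 : G.dist y' v ≤ G.dist y' u + 1 := by
      have := hG.connected.dist_triangle (u := y') (v := u) (w := v)
      rw [SimpleGraph.dist_eq_one_iff_adj.2 hvu.symm] at this
      exact this
    have := tree_parent_unique hG (r := v) hy'.symm hxy.symm (by omega) (by omega)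
    subst this
    omega
  subst hyu
  refine ⟨?_, rfl⟩
  have := SimpleGraph.dist_eq_one_iff_adj.2 hxy
  have h0 : G.dist x v = 0 := by omega
  exact hG.connected.dist_eq_zero_iff.1 h0

/-- A relation on the darts of a finite tree in which every dart has a non-backtracking successor
is empty. -/
theorem no_infinite_path [Finite V] (hG : G.IsTree) (R : V → V → Prop)
    (hR : ∀ v w, R v w → G.Adj v w) (hs : ∀ v w, R v w → ∃ z, z ≠ v ∧ R w z) (r s : V) :
    ¬ R r s := by
  intro hrs
  -- Darts pointing away from `r`. The successor of one with farthest head cannot point away from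
  -- `r` again, so it points towards `r` and turns back.
  let T : Set (V × V) := {q | R q.1 q.2 ∧ G.dist q.1 r < G.dist q.2 r}
  have hne : T.Nonempty := ⟨(r, s), hrs, by
    simp [(SimpleGraph.dist_eq_one_iff_adj.2 (hR _ _ hrs).symm)]⟩
  obtain ⟨⟨v, w⟩, ⟨h1, h2⟩, hmax⟩ :=
    Set.exists_max_image T (fun q => G.dist q.2 r) (Set.toFinite T) hne
  obtain ⟨z, hz, hwz⟩ := hs v w h1
  have hd := hG.dist_ne_of_adj r (hR _ _ hwz)
  rw [G.dist_comm, G.dist_comm (v := z)] at hd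
  rcases lt_or_gt_of_ne hd with hlt | hlt
  · exact absurd (hmax (w, z) ⟨hwz, hlt⟩) (by simpa using hlt)
  · exact hz (tree_parent_unique hG (hR _ _ hwz) (hR _ _ h1).symm hlt h2)

/-- A walk that enters from `u` through `v` and never turns back stays on the side of `v` and can
end only at a leaf. -/
theorem exists_leaf_side [Finite V] (hG : G.IsTree) {v u : V} (hvu : G.Adj v u) :
    ∃ x, Side G v u x ∧ (G.neighborSet x).ncard = 1 := by
  by_contra! hcon
  refine no_infinite_path hG
    (fun x y => G.Adj x y ∧ Side G v u y ∧ G.dist x v < G.dist y v ∨ (x = u ∧ y = v)) ?_ ?_ u v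
    (Or.inr ⟨rfl, rfl⟩)
  · rintro x y (h | ⟨rfl, rfl⟩)
    · exact h.1
    · exact hvu.symm
  · intro x y hxy
    have hadj : G.Adj x y := by
      rcases hxy with h | ⟨rfl, rfl⟩
      · exact h.1
      · exact hvu.symm
    have hy : Side G v u y := by
      rcases hxy with h | ⟨rfl, rfl⟩
      · exact h.2.1
      · exact side_self hvu
    have h2 : ∃ z, G.Adj y z ∧ z ≠ x := by
      by_contra! h
      apply hcon y hy
      rw [Set.ncard_eq_one]
      refine ⟨x, ?_⟩
      ext z
      simp only [SimpleGraph.mem_neighborSet, Set.mem_singleton_iff]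
      exact ⟨h z, fun h => h ▸ hadj.symm⟩
    obtain ⟨z, hz, hzx⟩ := h2
    refine ⟨z, hzx, Or.inl ⟨hz, ?_, ?_⟩⟩
    · rcases side_or hG hvu z with h | h
      · exact h
      · obtain ⟨rfl, rfl⟩ := side_crossing hG hvu hz hy h
        rcases hxy with h | h
        · simp at h
        · exact absurd h.1.symm hzx
    · have hd := hG.dist_ne_of_adj v hz
      rw [G.dist_comm, G.dist_comm (v := z)] at hd
      rcases lt_or_gt_of_ne hd with hlt | hlt
      · exact hlt
      · rcases hxy with h | ⟨rfl, rfl⟩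
        · exact absurd (tree_parent_unique hG hz hadj.symm hlt h.2.2) hzx
        · simp at hlt

end Tree

/-! ### Weighted distances. -/

namespace Network

variable {V : Type*} (N : Network V)

theorem weight_nonneg {u v : V} (p : N.G.Walk u v) : 0 ≤ (p.edges.map N.len).sum := by
  apply List.sum_nonneg
  intro x hx
  obtain ⟨e, he, rfl⟩ := List.mem_map.1 hx
  exact (N.len_pos e (p.edges_subset_edgeSet he)).le

theorem len_pos_of_adj {u v : V} (h : N.G.Adj u v) : 0 < N.len s(u, v) := N.len_pos _ h

theorem len_comm (u v : V) : N.len s(u, v) = N.len s(v, u) := by rw [Sym2.eq_swap]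

theorem dist_le_weight {u v : V} (p : N.G.Walk u v) : N.dist u v ≤ (p.edges.map N.len).sum :=
  ciInf_le ⟨0, by rintro _ ⟨p, rfl⟩; exact N.weight_nonneg p⟩ p

theorem dist_nonneg (u v : V) : 0 ≤ N.dist u v := Real.iInf_nonneg fun p => N.weight_nonneg p

theorem dist_self (u : V) : N.dist u u = 0 :=
  le_antisymm (by simpa using N.dist_le_weight (.nil : N.G.Walk u u)) (N.dist_nonneg u u)

variable {N}

theorem le_dist (hN : N.G.Connected) {u v : V} {c : ℝ} (h : ∀ p : N.G.Walk u v, c ≤ (p.edges.map N.len).sum) :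
    c ≤ N.dist u v :=
  haveI : Nonempty (N.G.Walk u v) := hN u v
  le_ciInf h

theorem dist_symm (hN : N.G.Connected) (u v : V) : N.dist u v = N.dist v u := by
  have : ∀ u v, N.dist u v ≤ N.dist v u := fun u v => le_dist hN fun p => by
    simpa using N.dist_le_weight p.reverse
  exact le_antisymm (this u v) (this v u)

theorem dist_triangle (hN : N.G.Connected) (u v w : V) : N.dist u w ≤ N.dist u v + N.dist v w := by
  rw [← sub_le_iff_le_add]
  refine le_dist hN fun p => ?_
  rw [sub_le_iff_le_add, ← sub_le_iff_le_add']
  refine le_dist hN fun q => ?_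
  have := N.dist_le_weight (p.append q)
  simp at this
  linarith

theorem dist_le_len {u v : V} (h : N.G.Adj u v) : N.dist u v ≤ N.len s(u, v) := by
  simpa using N.dist_le_weight h.toWalk

/-- Every walk from `b` to `c` changes sides, and by `side_crossing` it can do so only along the
edge `vu`. -/
theorem dist_across (hT : N.G.IsTree) {v u b c : V} (h : N.G.Adj v u) (hb : Side N.G v u b)
    (hc : Side N.G u v c) : N.dist b v + N.len s(v, u) + N.dist u c ≤ N.dist b c := by
  refine le_dist hT.connected fun p => ?_
  induction p with
  | nil => exact absurd hc hb.not_side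
  | @cons b b' c e p ih =>
    simp only [SimpleGraph.Walk.edges_cons, List.map_cons, List.sum_cons]
    rcases side_or hT h b' with h' | h'
    · have := ih h' hc
      have := dist_triangle hT.connected b b' v
      have := dist_le_len e
      linarith
    · obtain ⟨rfl, rfl⟩ := side_crossing hT h e hb h'
      have := N.dist_le_weight p
      rw [N.dist_self]
      linarith

/-! ### Points in barycentric coordinates. -/

variable (N) in
theorem place_zero (u v : V) : N.place u v 0 = nodePoint u := by
  funext z
  simp [place, nodePoint]

theorem place_len {u v : V} (h : N.G.Adj u v) : N.place u v (N.len s(u, v)) = nodePoint v := by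
  funext z
  simp [place, nodePoint, div_self (len_pos_of_adj N h).ne']

theorem place_swap {u v : V} (h : N.G.Adj u v) (x : ℝ) :
    N.place v u (N.len s(u, v) - x) = N.place u v x := by
  funext z
  have := (len_pos_of_adj N h).ne'
  simp only [place, N.len_comm v u, sub_div, div_self this]
  rw [add_comm]
  congr 2
  ring

theorem nodePoint_injective : Function.Injective (nodePoint : V → V → ℝ) := by
  intro u v h
  by_contra hne
  have := congrFun h u
  simp [nodePoint, hne] at this

theorem place_left_pos {u v : V} (h : N.G.Adj u v) {x : ℝ} (hx : x < N.len s(u, v)) :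
    0 < N.place u v x u := by
  have := (div_lt_one (len_pos_of_adj N h)).2 hx
  simp [place, h.ne, this]

theorem place_right {u v : V} (h : N.G.Adj u v) (x : ℝ) :
    N.place u v x v = x / N.len s(u, v) := by
  simp [place, h.ne.symm]

theorem place_right_pos {u v : V} (h : N.G.Adj u v) {x : ℝ} (hx : 0 < x) :
    0 < N.place u v x v := by
  rw [place_right h]
  exact div_pos hx (len_pos_of_adj N h)

theorem eq_or_eq_of_place_ne_zero {u v z : V} {x : ℝ} (h : N.place u v x z ≠ 0) :
    z = u ∨ z = v := by
  by_contra! hcon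
  simp [place, hcon.1, hcon.2] at h

theorem place_ne_nodePoint {u v : V} (h : N.G.Adj u v) {x : ℝ} (h0 : 0 < x)
    (h1 : x < N.len s(u, v)) (w : V) : N.place u v x ≠ nodePoint w := by
  intro he
  have a := place_left_pos h h1
  have b := place_right_pos h h0
  have key : ∀ z, 0 < N.place u v x z → z = w := by
    intro z hz
    rw [he] at hz
    by_contra hne
    simp [nodePoint, hne] at hz
  exact h.ne ((key u a).trans (key v b).symm)

/-- An interior point has exactly two nonzero coordinates, which reveal the edge up to orientation;
their values reveal the offset. -/
theorem place_eq_place {u v u' v' : V} (h : N.G.Adj u v) (h' : N.G.Adj u' v') {x x' : ℝ}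
    (h0 : 0 < x) (h1 : x < N.len s(u, v)) (he : N.place u v x = N.place u' v' x') :
    (u = u' ∧ v = v' ∧ x = x') ∨ (u = v' ∧ v = u' ∧ x + x' = N.len s(u, v)) := by
  have a := place_left_pos h h1
  have b := place_right_pos h h0
  rw [he] at a b
  have hL := len_pos_of_adj N h
  rcases eq_or_eq_of_place_ne_zero a.ne' with rfl | rfl <;>
  rcases eq_or_eq_of_place_ne_zero b.ne' with hv | hv
  · exact absurd hv.symm h.ne
  · subst hv
    left
    have := congrFun he v
    rw [place_right h, place_right h, div_left_inj' hL.ne'] at this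
    exact ⟨rfl, rfl, this⟩
  · subst hv
    right
    have := congrFun he v
    rw [← place_swap h', place_right h, place_right h, N.len_comm v u,
      div_left_inj' hL.ne'] at this
    exact ⟨rfl, rfl, by linarith⟩
  · exact absurd hv.symm h.ne

/-! ### Lower bound for centralized strategies. -/

/-- The point `p` is at distance at most `s` from the node `a`. -/
def Near (N : Network V) (a : V) (p : V → ℝ) (s : ℝ) : Prop :=
  (∃ w, p = nodePoint w ∧ N.dist a w ≤ s) ∨
  ∃ u v x, N.G.Adj u v ∧ 0 < x ∧ x < N.len s(u, v) ∧ p = N.place u v x ∧ N.dist a u + x ≤ s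

theorem Near.mono {a : V} {p : V → ℝ} {s t : ℝ} (h : N.Near a p s) (hst : s ≤ t) :
    N.Near a p t := by
  rcases h with ⟨w, h1, h2⟩ | ⟨u, v, x, h1, h2, h3, h4, h5⟩
  · exact Or.inl ⟨w, h1, h2.trans hst⟩
  · exact Or.inr ⟨u, v, x, h1, h2, h3, h4, h5.trans hst⟩

theorem near_place (hN : N.G.Connected) {a u v : V} {x s : ℝ} (h : N.G.Adj u v) (h0 : 0 ≤ x)
    (h1 : x ≤ N.len s(u, v)) (hs : N.dist a u + x ≤ s) : N.Near a (N.place u v x) s := by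
  rcases h0.eq_or_lt with rfl | h0
  · exact Or.inl ⟨u, N.place_zero u v, by linarith⟩
  rcases h1.eq_or_lt with rfl | h1
  · refine Or.inl ⟨v, place_len h, ?_⟩
    have := dist_triangle hN a u v
    have := dist_le_len h
    linarith
  · exact Or.inr ⟨u, v, x, h, h0, h1, rfl, hs⟩

theorem Near.move (hN : N.G.Connected) {a u v : V} {x y s : ℝ} (h : N.G.Adj u v) (h0 : 0 ≤ x)
    (hxy : x ≤ y) (hy : y ≤ N.len s(u, v)) (hs : N.Near a (N.place u v x) s) :
    N.Near a (N.place u v y) (s + (y - x)) := by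
  rcases hs with ⟨w, h1, h2⟩ | ⟨u', v', x', h1, h2, h3, h4, h5⟩
  · rcases h0.eq_or_lt with rfl | h0
    · rw [place_zero] at h1
      obtain rfl := nodePoint_injective h1
      exact near_place hN h hxy hy (by linarith)
    · rcases (hxy.trans hy).eq_or_lt with rfl | hx
      · obtain rfl := le_antisymm hxy hy
        rw [place_len h] at h1 ⊢
        obtain rfl := nodePoint_injective h1
        exact Or.inl ⟨v, rfl, by linarith⟩
      · exact absurd h1 (place_ne_nodePoint h h0 hx w)
  · rcases place_eq_place h1 h h2 h3 h4.symm with ⟨rfl, rfl, rfl⟩ | ⟨rfl, rfl, h6⟩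
    · exact near_place hN h (h0.trans hxy) hy (by linarith)
    -- The movement goes back towards the end from which the offset is measured.
    · rw [← place_swap h]
      refine near_place hN h1 (by linarith) ?_ ?_
      · rw [N.len_comm u' v']; linarith
      · rw [N.len_comm u' v'] at h6; linarith

theorem Near.dist_le (hN : N.G.Connected) {a b : V} {p : V → ℝ} {s t : ℝ} (ha : N.Near a p s)
    (hb : N.Near b p t) : N.dist a b ≤ s + t := by
  rcases ha with ⟨w, h1, h2⟩ | ⟨u, v, x, h1, h2, h3, h4, h5⟩ <;>
  rcases hb with ⟨w', k1, k2⟩ | ⟨u', v', x', k1, k2, k3, k4, k5⟩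
  · obtain rfl := nodePoint_injective (h1.symm.trans k1)
    have := dist_triangle hN a w b
    rw [dist_symm hN w b] at this
    linarith
  · exact absurd (k4.symm.trans h1) (place_ne_nodePoint k1 k2 k3 w)
  · exact absurd (h4.symm.trans k1) (place_ne_nodePoint h1 h2 h3 w')
  · rcases place_eq_place h1 k1 h2 h3 (h4.symm.trans k4) with ⟨rfl, rfl, rfl⟩ | ⟨rfl, rfl, h6⟩
    · have := dist_triangle hN a u b
      rw [dist_symm hN u b] at this
      linarith
    -- The two routes enter the edge from opposite ends and together cover exactly its length.
    · have := dist_triangle hN a u b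
      have := dist_triangle hN u v b
      rw [dist_symm hN v b] at this
      have := dist_le_len h1
      linarith

theorem IsPlan.power_nonneg {p : V → ℝ} {t : ℝ} {ms : List (Movement V)} (h : N.IsPlan p t ms) :
    0 ≤ planPower ms := by
  induction ms generalizing p t with
  | nil => simp [planPower]
  | cons m ms ih =>
    obtain ⟨-, -, -, h1, -, -, h2⟩ := h
    have := ih h2
    simp only [planPower, List.map_cons, List.sum_cons] at this ⊢
    linarith

theorem IsPlan.near (hN : N.G.Connected) {a : V} {p : V → ℝ} {t s : ℝ} {ms : List (Movement V)}
    (h : N.IsPlan p t ms) (hp : N.Near a p s) (r : ℝ) :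
    N.Near a (N.planPos p ms r) (s + planPower ms) := by
  induction ms generalizing p t s with
  | nil => simpa [planPower, planPos] using hp
  | cons m ms ih =>
    have hnn := h.power_nonneg
    obtain ⟨-, hadj, h0, h1, h2, h3, h4⟩ := h
    have hms := h4.power_nonneg
    have hpow : planPower (m :: ms) = (m.y - m.x) + planPower ms := by simp [planPower]
    subst h3
    simp only [planPos]
    split_ifs with c1 c2
    · exact hp.mono (by linarith)
    · exact (hp.move hN hadj h0 (y := m.x + (r - m.start)) (by linarith)
        (by linarith)).mono (by linarith)
    · exact (ih h4 (hp.move hN hadj h0 h1 h2)).mono (by linarith)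

/-- In a centralized convergecast with power `P`, the two parts of every splitting contain nodes
at distance at most `2 * P`. -/
theorem CentralizedConvergecast.exists_dist_le (hN : N.G.Connected) {A : Finset V} {P : ℝ}
    (h : N.CentralizedConvergecast A P) {X : Set V} (hX : X.Nonempty) (hXA : X ⊂ (A : Set V)) :
    ∃ x ∈ X, ∃ y ∈ (A : Set V) \ X, N.dist x y ≤ 2 * P := by
  obtain ⟨plan, h1, h2, a, t, h3⟩ := h
  by_contra! hcon
  have hnear : ∀ (i : A) r, N.Near i.1 (N.planPos (nodePoint i.1) (plan i) r) P := fun i r =>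
    ((h1 i).near hN (s := 0) (Or.inl ⟨i.1, rfl, (N.dist_self _).le⟩) r).mono
      (by linarith [h2 i])
  have hmeet : ∀ (i j : A) r, N.planPos (nodePoint i.1) (plan i) r =
      N.planPos (nodePoint j.1) (plan j) r → i.1 ∈ X → j.1 ∈ X := by
    intro i j r he hi
    by_contra hj
    have := hcon i.1 hi j.1 ⟨j.2, hj⟩
    have h4 := hnear i r
    rw [he] at h4
    linarith [h4.dist_le hN (hnear j r)]
  -- If no meeting joins the two parts, information never leaves the part in which it started.
  have key : ∀ b a t, Informed (fun i : A => N.planPos (nodePoint i.1) (plan i)) b a t →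
      (b.1 ∈ X ↔ a.1 ∈ X) := by
    intro b a t hi
    induction hi with
    | own => rfl
    | keep _ _ ih => exact ih
    | meet _ he ih => exact ih.trans ⟨hmeet _ _ _ he, hmeet _ _ _ he.symm⟩
  obtain ⟨x, hx⟩ := hX
  obtain ⟨y, hyA, hy⟩ := Set.exists_of_ssubset hXA
  exact hy ((key _ _ _ (h3 ⟨y, hyA⟩)).2 ((key _ _ _ (h3 ⟨x, hXA.1 hx⟩)).1 hx))

theorem bddBelow_dist {s : Set V} {t : Set V} :
    BddBelow (Set.range fun q : s × t => N.dist q.1 q.2) :=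
  ⟨0, by rintro _ ⟨q, rfl⟩; exact N.dist_nonneg _ _⟩

theorem D_le_of_convergecast (hN : N.G.Connected) {A : Finset V} (hA : A.Nonempty) {P : ℝ}
    (h : N.CentralizedConvergecast A P) : N.D A ≤ 2 * P := by
  refine Real.iSup_le ?_ ?_
  · rintro ⟨X, hX, hXA⟩
    obtain ⟨x, hx, y, hy, hd⟩ := h.exists_dist_le hN hX hXA
    exact (ciInf_le bddBelow_dist
      ((⟨x, hx⟩, ⟨y, hy⟩) : ↥X × ((A : Set V) \ X : Set V))).trans hd
  -- `Real.iSup_le` also needs `0 ≤ 2 * P`: without any splitting the supremum is `0`.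
  · obtain ⟨a, ha⟩ := hA
    obtain ⟨plan, h1, h2, -⟩ := h
    have := (h1 ⟨a, ha⟩).power_nonneg
    linarith [h2 ⟨a, ha⟩]

theorem ofReal_D_le (hN : N.G.Connected) {A : Finset V} (hA : A.Nonempty) :
    ENNReal.ofReal (N.D A) ≤ 2 * N.optimalPower A := by
  unfold optimalPower
  rw [ENNReal.mul_iInf_of_ne (by norm_num) (by norm_num)]
  refine le_iInf fun P => ?_
  rw [ENNReal.mul_iInf_of_ne (by norm_num) (by norm_num)]
  refine le_iInf fun h => ?_
  have := ENNReal.ofReal_le_ofReal (D_le_of_convergecast hN hA h)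
  rwa [ENNReal.ofReal_mul (by norm_num), ENNReal.ofReal_ofNat] at this

theorem D_nonneg (A : Finset V) : 0 ≤ N.D A :=
  Real.iSup_nonneg fun _ => Real.iInf_nonneg fun _ => N.dist_nonneg _ _

theorem exists_dist_le_D [Finite V] {A : Finset V} {X : Set V}
    (h1 : ∃ b ∈ A, b ∈ X) (h2 : ∃ c ∈ A, c ∉ X) :
    ∃ b ∈ A, b ∈ X ∧ ∃ c ∈ A, c ∉ X ∧ N.dist b c ≤ N.D A := by
  obtain ⟨b, hbA, hb⟩ := h1
  obtain ⟨c, hcA, hc⟩ := h2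
  let Y : Set V := A ∩ X
  have hY : Y.Nonempty ∧ Y ⊂ (A : Set V) :=
    ⟨⟨b, hbA, hb⟩, Set.inter_subset_left, fun h => hc (h hcA).2⟩
  have : Nonempty (↥Y × ((A : Set V) \ Y : Set V)) :=
    ⟨⟨b, hbA, hb⟩, ⟨c, hcA, fun h => hc h.2⟩⟩
  obtain ⟨⟨x, y⟩, hq⟩ := exists_eq_ciInf_of_finite
    (f := fun q : ↥Y × ((A : Set V) \ Y : Set V) => N.dist q.1 q.2)
  refine ⟨x.1, x.2.1, x.2.2, y.1, y.2.1, fun h => y.2.2 ⟨y.2.1, h⟩, ?_⟩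
  refine hq.trans_le ?_
  exact le_ciSup (f := fun X : {X : Set V // X.Nonempty ∧ X ⊂ (A : Set V)} =>
    ⨅ q : (X.1 : Set V) × ((A : Set V) \ X.1 : Set V), N.dist q.1 q.2)
    (Set.finite_range _).bddAbove ⟨Y, hY⟩

end Network

/-! ### The algorithm. -/

/-- No agent of the group `g` at a node of degree `d` has entered the node through the port `p`. -/
def FreePort {S : Type} (d : ℕ) (g : Multiset (View S)) (p : ℕ) : Prop :=
  p ∈ Set.Icc 1 d ∧ ∀ w ∈ g, w.entry ≠ some p

/-- Agents at a common node are compared by the power used; ties are broken by the entry ports. -/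
def rank {S : Type} (w : View S) : ℝ ×ₗ ℕ := toLex (w.used, w.entry.getD 0)

/-- The convergecast algorithm: an agent waits at a node until agents have arrived through all ports
but one; then the agent that has used the least power leaves through the remaining port and moves
until it reaches a node or meets another agent inside the edge. It needs no memory. -/
def greedy : Algorithm where
  Memory := Unit
  init := ()
  act
    | some d, me, others =>
      ((), if h : (∃! p, FreePort d (me ::ₘ others) p) ∧ ∀ w ∈ others, rank me < rank w then
        .leave h.1.choose ⊤ else .stay)
    | none, _, _ => ((), .stay)

namespace Network

variable {V : Type*} {N : Network V} {A : Finset V}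

/-! ### Agents at a common point. -/

section Together

variable {I : Type*} {S : Type} {C : Config V I S}

variable (N C) in
/-- Agents inside edges are at interior points, at most one in each direction. -/
structure Interior : Prop where
  edge : ∀ {a v u x}, (C a).loc = .edge v u x → N.G.Adj v u ∧ 0 < x ∧ x < N.len s(v, u)
  uniq : ∀ {a b v u x y}, (C a).loc = .edge v u x → (C b).loc = .edge v u y → a = b

theorem Together.refl (a : I) : N.Together C a a := rfl

theorem Together.of_loc_eq {a b : I} (h : (C a).loc = (C b).loc) : N.Together C a b := by
  unfold Together
  rw [h]

theorem Interior.together_node (hC : N.Interior C) {a b : I} {v : V} (ha : (C a).loc = .node v) :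
    N.Together C a b ↔ (C b).loc = .node v := by
  unfold Together
  rw [ha]
  constructor
  · intro h
    cases hb : (C b).loc with
    | node w =>
      rw [hb] at h
      rw [nodePoint_injective h]
    | edge u w x =>
      rw [hb] at h
      obtain ⟨h1, h2, h3⟩ := hC.edge hb
      exact absurd h.symm (place_ne_nodePoint h1 h2 h3 v)
  · intro h
    rw [h]

theorem Interior.together_edge (hC : N.Interior C) {a b : I} {v u : V} {x : ℝ}
    (ha : (C a).loc = .edge v u x) (h : N.Together C a b) :
    b = a ∨ ∃ y, (C b).loc = .edge u v y ∧ x + y = N.len s(v, u) := by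
  obtain ⟨h1, h2, h3⟩ := hC.edge ha
  unfold Together at h
  rw [ha] at h
  cases hb : (C b).loc with
  | node w =>
    rw [hb] at h
    exact absurd h (place_ne_nodePoint h1 h2 h3 w)
  | edge u' w y =>
    rw [hb] at h
    rcases place_eq_place h1 (hC.edge hb).1 h2 h3 h with ⟨rfl, rfl, -⟩ | ⟨rfl, rfl, h6⟩
    · exact Or.inl (hC.uniq hb ha)
    · exact Or.inr ⟨y, rfl, h6⟩

theorem together_opposite {a b : I} {v u : V} {x y : ℝ} (h : N.G.Adj v u)
    (ha : (C a).loc = .edge v u x) (hb : (C b).loc = .edge u v y) :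
    N.Together C a b ↔ x + y = N.len s(v, u) := by
  unfold Together
  rw [ha, hb]
  simp only [point]
  constructor
  · intro he
    rw [← place_swap h.symm y] at he
    have := congrFun he u
    rw [place_right h, place_right h, div_left_inj' (len_pos_of_adj N h).ne',
      N.len_comm u v] at this
    linarith
  · intro he
    rw [← place_swap h x, ← he]
    congr 1
    ring

end Together

/-! ### The invariants; `F` and `Dn` record history that a configuration does not show. -/

variable (N A) in
/-- What holds throughout the execution: `F v u` means that an agent has left `v` towards `u`, and
`Dn v u` that it has arrived at `u`. -/
structure Core (C : Config V A greedy.Memory) (F Dn : V → V → Prop) : Prop where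
  adj : ∀ {v u}, F v u → N.G.Adj v u
  started : ∀ {v u}, Dn v u → F v u
  anti : ∀ {v u}, Dn v u → ¬ F u v
  pred : ∀ {v u w}, F v u → N.G.Adj v w → w ≠ u → Dn w v
  owner : ∀ {v u}, F v u → ¬ Dn v u → ∃ a x, (C a).loc = .edge v u x
  edge : ∀ {a v u x}, (C a).loc = .edge v u x →
    F v u ∧ ¬ Dn v u ∧ 0 ≤ x ∧ x < N.len s(v, u) ∧ ((C a).ahead = 0 ∨ (C a).ahead = ⊤)
  uniq : ∀ {a b v u x y}, (C a).loc = .edge v u x → (C b).loc = .edge v u y → a = b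
  opposite : ∀ {a b v u x y}, (C a).loc = .edge v u x → (C b).loc = .edge u v y →
    (C a).ahead = 0 → (C b).ahead = 0 ∧ x + y = N.len s(v, u)
  stopped : ∀ {a v u x}, (C a).loc = .edge v u x → (C a).ahead = 0 → 0 < x ∧ F u v
  stopped_known : ∀ {a v u x}, (C a).loc = .edge v u x → (C a).ahead = 0 → ∀ i, i ∈ (C a).known
  entry : ∀ {a v}, (C a).loc = .node v →
    ((C a).view.entry = none ∧ a.1 = v ∧ (C a).view.used = 0) ∨
    ∃ w, N.G.Adj v w ∧ Dn w v ∧ (C a).view.entry = some (N.port v w)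
  entry_inj : ∀ {a b v}, (C a).loc = .node v → (C b).loc = .node v →
    (C a).view.entry = (C b).view.entry → a = b
  used_le : ∀ a, (C a).view.used ≤ N.D A
  -- The estimate behind the power bound; `exists_pair_dist_le_D` supplies a suitable `b`.
  edge_used : ∀ {a v u x}, (C a).loc = .edge v u x → ∀ b ∈ A, Side N.G v u b →
    (C a).view.used ≤ N.dist b v + x
  edge_known : ∀ {a v u x}, (C a).loc = .edge v u x → ∀ b : A, Side N.G v u b → b ∈ (C a).known
  home : ∀ {a : A}, (∀ u, ¬ F a u) → (C a).loc = .node a.1 ∧ (C a).view.used = 0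
  arrived : ∀ {v w}, (∀ u, ¬ F v u) → Dn w v → ∃ a, (C a).loc = .node v ∧
    (C a).view.entry = some (N.port v w) ∧
    ∀ b ∈ A, Side N.G w v b → (C a).view.used ≤ N.dist b v

variable (N A) in
/-- The invariant that holds after every event. -/
structure Inv (C : Config V A greedy.Memory) (F Dn : V → V → Prop) : Prop
    extends Core N A C F Dn where
  node_ahead : ∀ {a v}, (C a).loc = .node v → (C a).ahead = 0
  opposite_lt : ∀ {a b v u x y}, (C a).loc = .edge v u x → (C b).loc = .edge u v y →
    (C a).ahead ≠ 0 → x + y < N.len s(v, u)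
  known : ∀ {a v}, (∀ u, ¬ F v u) → (C a).loc = .node v →
    ∀ b : A, (b.1 = v ∨ ∃ w, Dn w v ∧ Side N.G w v b) → b ∈ (C a).known
  -- A node lacking exactly one arrival would have been left when its agents were last activated.
  branch : ∀ {v w}, (∀ u, ¬ F v u) → N.G.Adj v w → ¬ Dn w v → ∃ z, z ≠ w ∧ N.G.Adj v z ∧ ¬ Dn z v

variable (N A) in
/-- The invariant that holds when an event takes place, before the agents in `W` are activated.
These agents are those at the nodes in `K` and those that meet inside edges. -/
structure Pre (C : Config V A greedy.Memory) (F Dn : V → V → Prop) (K : V → Prop) (W : Set A) :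
    Prop extends Core N A C F Dn where
  edge_pos : ∀ {a v u x}, (C a).loc = .edge v u x → 0 < x
  active : ∀ {v}, K v → ∀ u, ¬ F v u
  mem_node : ∀ {a v}, (C a).loc = .node v → (a ∈ W ↔ K v)
  mem_edge : ∀ {a v u x}, (C a).loc = .edge v u x → a ∈ W →
    ∃ b y, (C b).loc = .edge u v y ∧ x + y = N.len s(v, u)
  opposite_le : ∀ {a b v u x y}, (C a).loc = .edge v u x → (C b).loc = .edge u v y →
    (C a).ahead ≠ 0 → x + y ≤ N.len s(v, u)
  mem_opposite : ∀ {a b v u x y}, (C a).loc = .edge v u x → (C b).loc = .edge u v y →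
    (C a).ahead ≠ 0 → x + y = N.len s(v, u) → a ∈ W
  node_ahead : ∀ {a v}, (C a).loc = .node v → ¬ K v → (C a).ahead = 0
  known : ∀ {v}, (∀ u, ¬ F v u) → ∀ b : A, (b.1 = v ∨ ∃ w, Dn w v ∧ Side N.G w v b) →
    ∃ a, (C a).loc = .node v ∧ b ∈ (C a).known
  branch : ∀ {v w}, (∀ u, ¬ F v u) → ¬ K v → N.G.Adj v w → ¬ Dn w v →
    ∃ z, z ≠ w ∧ N.G.Adj v z ∧ ¬ Dn z v

variable (N) in
/-- Agents have arrived at `v` from all neighbours but `u`. -/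
def Exit (Dn : V → V → Prop) (v u : V) : Prop :=
  N.G.Adj v u ∧ ¬ Dn u v ∧ ∀ w, N.G.Adj v w → w ≠ u → Dn w v

/-! ### Activation of the agents. -/

variable {C : Config V A greedy.Memory} {F Dn : V → V → Prop} {K : V → Prop} {W : Set A}

theorem Pre.interior (h : Pre N A C F Dn K W) : N.Interior C where
  edge ha := ⟨h.adj (h.edge ha).1, h.edge_pos ha, (h.edge ha).2.2.2.1⟩
  uniq := h.uniq

theorem port_inj {v u w : V} (hu : N.G.Adj v u) (hw : N.G.Adj v w)
    (h : N.port v u = N.port v w) : u = w := (N.port_bij v).injOn hu hw h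

theorem one_le_port {v u : V} (hu : N.G.Adj v u) : 1 ≤ N.port v u :=
  ((N.port_bij v).mapsTo hu).1

theorem activate_view (a : A) : (N.activate greedy W C a).view.entry = (C a).view.entry ∧
    (N.activate greedy W C a).view.used = (C a).view.used := by
  unfold activate
  dsimp only
  split_ifs <;> exact ⟨rfl, rfl⟩

theorem activate_known (a : A) :
    (N.activate greedy W C a).known = {i | ∃ b, N.Together C a b ∧ i ∈ (C b).known} := by
  unfold activate
  dsimp only
  split_ifs <;> rfl

theorem activate_of_notMem {a : A} (h : a ∉ W) :
    (N.activate greedy W C a).loc = (C a).loc ∧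
    (N.activate greedy W C a).ahead = (C a).ahead := by
  simp [activate, h]

theorem activate_edge {a : A} {v u : V} {x : ℝ} (ha : (C a).loc = .edge v u x) :
    (N.activate greedy W C a).loc = .edge v u x ∧
    (N.activate greedy W C a).ahead = if a ∈ W then 0 else (C a).ahead := by
  by_cases h : a ∈ W
  · simp [activate, h, ha, sense, greedy, execute]
  · simp [activate_of_notMem h, ha, h]

theorem activate_of_mem {a : A} (h : a ∈ W) : ∃ others : Multiset (View greedy.Memory),
    (∀ w, w ∈ others ↔ ∃ b, b ≠ a ∧ N.Together C a b ∧ (C b).view = w) ∧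
    (N.activate greedy W C a).loc =
      (N.execute (C a).loc (greedy.act (N.sense (C a).loc) (C a).view others).2).1 ∧
    (N.activate greedy W C a).ahead =
      (N.execute (C a).loc (greedy.act (N.sense (C a).loc) (C a).view others).2).2 := by
  unfold activate
  dsimp only
  rw [if_pos h]
  refine ⟨_, fun w => ?_, rfl, rfl⟩
  simp only [Multiset.mem_map, Finset.mem_val, Finset.mem_filter, Finset.mem_univ, true_and,
    and_assoc]

/-- As long as nobody has left `v`, for every traversed dart into `v` an agent with that entry port
is still there. The agents present thus show exactly which neighbours are missing. -/
theorem Pre.freePort_iff (h : Pre N A C F Dn K W) {a : A} {v : V} (ha : (C a).loc = .node v)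
    (hK : K v) {others : Multiset (View greedy.Memory)}
    (ho : ∀ w, w ∈ others ↔ ∃ b, b ≠ a ∧ (C b).loc = .node v ∧ (C b).view = w) (p : ℕ) :
    FreePort (N.deg v) ((C a).view ::ₘ others) p ↔
    ∃ w, N.G.Adj v w ∧ ¬ Dn w v ∧ N.port v w = p := by
  have hg : ∀ w, w ∈ (C a).view ::ₘ others ↔ ∃ b, (C b).loc = .node v ∧ (C b).view = w := by
    intro w
    rw [Multiset.mem_cons, ho]
    constructor
    · rintro (rfl | ⟨b, -, hb, rfl⟩)
      · exact ⟨a, ha, rfl⟩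
      · exact ⟨b, hb, rfl⟩
    · rintro ⟨b, hb, rfl⟩
      by_cases hba : b = a
      · exact Or.inl (by rw [hba])
      · exact Or.inr ⟨b, hba, hb, rfl⟩
  unfold FreePort
  simp only [hg]
  constructor
  · rintro ⟨hp, hfree⟩
    obtain ⟨w, hw, rfl⟩ := (N.port_bij v).surjOn hp
    refine ⟨w, hw, fun hd => ?_, rfl⟩
    obtain ⟨b, hb, he, -⟩ := h.arrived (h.active hK) hd
    exact hfree _ ⟨b, hb, rfl⟩ he
  · rintro ⟨w, hw, hd, rfl⟩
    refine ⟨(N.port_bij v).mapsTo hw, ?_⟩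
    rintro _ ⟨b, hb, rfl⟩ he
    rcases h.entry hb with ⟨h1, -⟩ | ⟨w', h1, h2, h3⟩
    · rw [h1] at he
      cases he
    · rw [h3] at he
      obtain rfl := port_inj h1 hw (Option.some.inj he)
      exact hd h2

theorem Pre.activate_node (h : Pre N A C F Dn K W) {a : A} {v : V} (ha : (C a).loc = .node v)
    (hK : K v) :
    (∃ u, Exit N Dn v u ∧
      (∀ b, b ≠ a → (C b).loc = .node v → rank (C a).view < rank (C b).view) ∧
      (N.activate greedy W C a).loc = .edge v u 0 ∧ (N.activate greedy W C a).ahead = ⊤) ∨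
    ((∀ u, Exit N Dn v u →
      ¬ ∀ b, b ≠ a → (C b).loc = .node v → rank (C a).view < rank (C b).view) ∧
      (N.activate greedy W C a).loc = .node v ∧ (N.activate greedy W C a).ahead = 0) := by
  obtain ⟨others, ho, hl, hd⟩ := activate_of_mem (N := N) (C := C) ((h.mem_node ha).2 hK)
  simp only [h.interior.together_node ha] at ho
  have hfp := h.freePort_iff ha hK ho
  have hmin : (∀ w ∈ others, rank (C a).view < rank w) ↔
      ∀ b, b ≠ a → (C b).loc = .node v → rank (C a).view < rank (C b).view := by
    simp only [ho]
    constructor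
    · intro hh b h1 h2
      exact hh _ ⟨b, h1, h2, rfl⟩
    · rintro hh _ ⟨b, h1, h2, rfl⟩
      exact hh b h1 h2
  have huniq : ∀ u, Exit N Dn v u → ∃! p, FreePort (N.deg v) ((C a).view ::ₘ others) p := by
    rintro u ⟨h1, h2, h3⟩
    refine ⟨N.port v u, (hfp _).2 ⟨u, h1, h2, rfl⟩, fun p hp => ?_⟩
    obtain ⟨w, hw, hd, rfl⟩ := (hfp p).1 hp
    by_contra hne
    exact hd (h3 w hw fun e => hne (by rw [e]))
  rw [hl, hd]
  simp only [ha, sense, greedy]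
  split_ifs with hc
  · left
    have hp := (hfp hc.1.choose).1 hc.1.choose_spec.1
    have hp2 := hc.1.choose_spec.2
    set p := hc.1.choose with hpdef
    obtain ⟨w, hw, hd, hwp⟩ := hp
    have hex : (⊤ : ℝ≥0∞) ≠ 0 ∧ ∃ u, N.G.Adj v u ∧ N.port v u = p :=
      ⟨by simp, w, hw, hwp⟩
    have hch : hex.2.choose = w :=
      port_inj hex.2.choose_spec.1 hw (hex.2.choose_spec.2.trans hwp.symm)
    refine ⟨w, ⟨hw, hd, fun z hz hzw => ?_⟩, hmin.1 hc.2, ?_⟩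
    · by_contra hdz
      have := hp2 _ ((hfp _).2 ⟨z, hz, hdz, rfl⟩)
      exact hzw (port_inj hz hw (this.trans hwp.symm))
    · simp only [execute]
      rw [dif_pos hex, hch]
      exact ⟨rfl, rfl⟩
  · right
    exact ⟨fun u hu hh => hc ⟨huniq u hu, hmin.2 hh⟩, rfl, rfl⟩

/-- The node is not empty: either it lies in `A` and its own agent is at home, or it is no leaf and
some neighbour other than `u` has sent an agent. Distinct entry ports make the least rank strict. -/
theorem Pre.exists_leaver (h : Pre N A C F Dn K W) (hleaf : ∀ v, N.deg v = 1 → v ∈ A) {v u : V}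
    (hK : K v) (hu : Exit N Dn v u) : ∃ a, (C a).loc = .node v ∧
      ∀ b, b ≠ a → (C b).loc = .node v → rank (C a).view < rank (C b).view := by
  have hne : {a | (C a).loc = .node v}.Nonempty := by
    by_cases hv : v ∈ A
    · exact ⟨⟨v, hv⟩, (h.home (a := ⟨v, hv⟩) (h.active hK)).1⟩
    · have : ∃ w, N.G.Adj v w ∧ w ≠ u := by
        by_contra! hcon
        refine hv (hleaf v (Set.ncard_eq_one.2 ⟨u, ?_⟩))
        ext z
        exact ⟨fun hz => hcon z hz, fun hz => by rw [Set.mem_singleton_iff.1 hz]; exact hu.1⟩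
      obtain ⟨w, hw, hwu⟩ := this
      obtain ⟨a, ha, -⟩ := h.arrived (h.active hK) (hu.2.2 w hw hwu)
      exact ⟨a, ha⟩
  obtain ⟨a, ha, hmin⟩ := Set.exists_min_image _ (fun a => rank (C a).view) (Set.toFinite _) hne
  refine ⟨a, ha, fun b hba hb => lt_of_le_of_ne (hmin b hb) fun he => hba ?_⟩
  have he2 : (C a).view.entry.getD 0 = (C b).view.entry.getD 0 :=
    congrArg (fun q => (ofLex q).2) he
  refine (h.entry_inj ha hb ?_).symm
  -- Entry `none` is ranked as `0`, which is not a port number, so equal second components force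
  -- equal entries.
  rcases h.entry ha with ⟨h1, -⟩ | ⟨w, hw, -, h1⟩ <;>
  rcases h.entry hb with ⟨k1, -⟩ | ⟨w', hw', -, k1⟩ <;> rw [h1, k1] at he2 ⊢
  · have := one_le_port hw'
    simp at he2
    omega
  · have := one_le_port hw
    simp at he2
    omega
  · simpa using he2


theorem Pre.loc_of_activate_node (h : Pre N A C F Dn K W) {a : A} {v : V}
    (ha : (N.activate greedy W C a).loc = .node v) :
    (C a).loc = .node v ∧ (N.activate greedy W C a).ahead = 0 := by
  cases hl : (C a).loc with
  | edge u w x =>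
    rw [(activate_edge hl).1] at ha
    cases ha
  | node w =>
    by_cases hK : K w
    · rcases h.activate_node hl hK with ⟨u, -, -, h1, -⟩ | ⟨-, h1, h2⟩
      · rw [h1] at ha
        cases ha
      · rw [h1] at ha
        exact ⟨ha, h2⟩
    · have := activate_of_notMem (N := N) (C := C) (mt (h.mem_node hl).1 hK)
      rw [this.1, hl] at ha
      exact ⟨ha, this.2.trans (h.node_ahead hl hK)⟩

theorem Pre.loc_of_activate_edge (h : Pre N A C F Dn K W) {a : A} {v u : V} {x : ℝ}
    (ha : (N.activate greedy W C a).loc = .edge v u x) :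
    ((C a).loc = .edge v u x ∧
      (N.activate greedy W C a).ahead = if a ∈ W then 0 else (C a).ahead) ∨
    (x = 0 ∧ (N.activate greedy W C a).ahead = ⊤ ∧ (C a).loc = .node v ∧ K v ∧ Exit N Dn v u ∧
      ∀ b, b ≠ a → (C b).loc = .node v → rank (C a).view < rank (C b).view) := by
  cases hl : (C a).loc with
  | edge u' w y =>
    have := activate_edge (N := N) (W := W) hl
    rw [this.1] at ha
    cases ha
    exact Or.inl ⟨rfl, this.2⟩
  | node w =>
    by_cases hK : K w
    · rcases h.activate_node hl hK with ⟨u', h0, h3, h1, h2⟩ | ⟨-, h1, h2⟩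
      · rw [h1] at ha
        cases ha
        exact Or.inr ⟨rfl, h2, rfl, hK, h0, h3⟩
      · rw [h1] at ha
        cases ha
    · have := activate_of_notMem (N := N) (C := C) (mt (h.mem_node hl).1 hK)
      rw [this.1, hl] at ha
      cases ha

variable (N) in
/-- The darts that have been entered once the agents at the nodes in `K` have been activated. -/
def Extend (F Dn : V → V → Prop) (K : V → Prop) (v u : V) : Prop := F v u ∨ K v ∧ Exit N Dn v u

theorem Pre.activate_of_still (h : Pre N A C F Dn K W) {a : A} {v : V}
    (hv : ∀ u, ¬ Extend N F Dn K v u) (ha : (C a).loc = .node v) :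
    (N.activate greedy W C a).loc = .node v := by
  by_cases hK : K v
  · rcases h.activate_node ha hK with ⟨u, h1, -⟩ | ⟨-, h1, -⟩
    · exact absurd (Or.inr ⟨hK, h1⟩) (hv u)
    · exact h1
  · rw [(activate_of_notMem (mt (h.mem_node ha).1 hK)).1, ha]

theorem Pre.known_of_node (h : Pre N A C F Dn K W) {a : A} {v : V} (hv : ∀ u, ¬ F v u)
    (ha : (C a).loc = .node v) (b : A) (hb : b.1 = v ∨ ∃ w, Dn w v ∧ Side N.G w v b) :
    b ∈ (N.activate greedy W C a).known := by
  obtain ⟨c, hc, hbc⟩ := h.known hv b hb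
  rw [activate_known]
  exact ⟨c, (h.interior.together_node ha).2 hc, hbc⟩

theorem subset_activate_known (a : A) : (C a).known ⊆ (N.activate greedy W C a).known := by
  intro i hi
  rw [activate_known]
  exact ⟨a, Together.refl a, hi⟩

theorem Pre.activate_core (hT : N.G.IsTree) (hleaf : ∀ v, N.deg v = 1 → v ∈ A)
    (h : Pre N A C F Dn K W) : Core N A (N.activate greedy W C) (Extend N F Dn K) Dn where
  adj := by
    rintro v u (hf | hf)
    · exact h.adj hf
    · exact hf.2.1
  started hd := Or.inl (h.started hd)
  anti := by
    rintro v u hd (hf | hf)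
    · exact h.anti hd hf
    · exact hf.2.2.1 hd
  pred := by
    rintro v u w (hf | hf) hw hwu
    · exact h.pred hf hw hwu
    · exact hf.2.2.2 w hw hwu
  owner := by
    rintro v u (hf | ⟨hK, hf⟩) hd
    · obtain ⟨a, x, ha⟩ := h.owner hf hd
      exact ⟨a, x, (activate_edge ha).1⟩
    · obtain ⟨a, ha, hmin⟩ := h.exists_leaver hleaf hK hf
      rcases h.activate_node ha hK with ⟨u', h1, -, h2, -⟩ | ⟨h1, -⟩
      · refine ⟨a, 0, ?_⟩
        have : u' = u := by
          by_contra hne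
          exact h1.2.1 (hf.2.2 u' h1.1 hne)
        rw [h2, this]
      · exact absurd hmin (h1 u hf)
  edge := by
    intro a v u x ha
    rcases h.loc_of_activate_edge ha with ⟨h1, h2⟩ | ⟨rfl, h2, -, hK, h3, -⟩
    · obtain ⟨k1, k2, k3, k4, k5⟩ := h.edge h1
      refine ⟨Or.inl k1, k2, k3, k4, ?_⟩
      rw [h2]
      split_ifs
      · exact Or.inl rfl
      · exact k5
    · exact ⟨Or.inr ⟨hK, h3⟩, fun hd => h.active hK u (h.started hd), le_rfl,
        len_pos_of_adj N h3.1, Or.inr h2⟩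
  uniq := by
    intro a b v u x y ha hb
    rcases h.loc_of_activate_edge ha with ⟨h1, -⟩ | ⟨-, -, h1, hK, -, h2⟩ <;>
    rcases h.loc_of_activate_edge hb with ⟨k1, -⟩ | ⟨-, -, k1, kK, -, k2⟩
    · exact h.uniq h1 k1
    · exact absurd (h.edge h1).1 (h.active kK u)
    · exact absurd (h.edge k1).1 (h.active hK u)
    · by_contra hne
      exact lt_asymm (h2 b (Ne.symm hne) k1) (k2 a hne h1)
  opposite := by
    intro a b v u x y ha hb h0
    rcases h.loc_of_activate_edge ha with ⟨h1, h2⟩ | ⟨-, h2, -⟩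
    swap
    · rw [h2] at h0
      exact absurd h0 (by simp)
    rcases h.loc_of_activate_edge hb with ⟨k1, k2⟩ | ⟨-, -, -, kK, -, -⟩
    · have hxy : x + y = N.len s(v, u) := by
        by_cases haW : a ∈ W
        · obtain ⟨b', y', hb', hy'⟩ := h.mem_edge h1 haW
          obtain rfl := h.uniq hb' k1
          rw [k1] at hb'
          cases hb'
          exact hy'
        · rw [if_neg haW] at h2
          exact (h.opposite h1 k1 (h2.symm.trans h0)).2
      refine ⟨?_, hxy⟩
      rw [k2]
      by_cases hb0 : (C b).ahead = 0
      · simp [hb0]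
      · rw [if_pos (h.mem_opposite k1 h1 hb0 (by rw [N.len_comm u v]; linarith))]
    · exfalso
      by_cases haW : a ∈ W
      · obtain ⟨b', y', hb', -⟩ := h.mem_edge h1 haW
        exact h.active kK v (h.edge hb').1
      · rw [if_neg haW] at h2
        exact h.active kK v (h.stopped h1 (h2.symm.trans h0)).2
  stopped := by
    intro a v u x ha h0
    rcases h.loc_of_activate_edge ha with ⟨h1, h2⟩ | ⟨-, h2, -⟩
    swap
    · rw [h2] at h0
      exact absurd h0 (by simp)
    refine ⟨h.edge_pos h1, Or.inl ?_⟩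
    by_cases haW : a ∈ W
    · obtain ⟨b', y', hb', -⟩ := h.mem_edge h1 haW
      exact (h.edge hb').1
    · rw [if_neg haW] at h2
      exact (h.stopped h1 (h2.symm.trans h0)).2
  stopped_known := by
    intro a v u x ha h0 i
    rcases h.loc_of_activate_edge ha with ⟨h1, h2⟩ | ⟨-, h2, -⟩
    swap
    · rw [h2] at h0
      exact absurd h0 (by simp)
    by_cases haW : a ∈ W
    · obtain ⟨b, y, hb, hy⟩ := h.mem_edge h1 haW
      have hadj := h.adj (h.edge h1).1
      -- The two agents come from opposite ends, and each already knows its own side.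
      rcases side_or hT hadj i.1 with hi | hi
      · exact subset_activate_known a (h.edge_known h1 i hi)
      · rw [activate_known]
        exact ⟨b, (together_opposite hadj h1 hb).2 hy, h.edge_known hb i hi⟩
    · rw [if_neg haW] at h2
      exact subset_activate_known a (h.stopped_known h1 (h2.symm.trans h0) i)
  entry := by
    intro a v ha
    rw [(activate_view a).1, (activate_view a).2]
    exact h.entry (h.loc_of_activate_node ha).1
  entry_inj := by
    intro a b v ha hb he
    rw [(activate_view a).1, (activate_view b).1] at he
    exact h.entry_inj (h.loc_of_activate_node ha).1 (h.loc_of_activate_node hb).1 he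
  used_le a := by
    rw [(activate_view a).2]
    exact h.used_le a
  edge_used := by
    intro a v u x ha b hb hs
    rw [(activate_view a).2]
    rcases h.loc_of_activate_edge ha with ⟨h1, -⟩ | ⟨rfl, -, h1, hK, h2, h3⟩
    · exact h.edge_used h1 b hb hs
    · rw [add_zero]
      -- The leaver has used no more than any agent at `v`. For given `b`, compare it with the agent
      -- at home if `b = v`, and otherwise with the one that arrived from the direction of `b`.
      have hle : ∀ c, (C c).loc = .node v → (C a).view.used ≤ (C c).view.used := by
        intro c hc
        by_cases hca : c = a
        · rw [hca]
        · have := (h3 c hca hc).le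
          rw [rank, rank, Prod.Lex.toLex_le_toLex] at this
          rcases this with hlt | ⟨heq, -⟩
          · exact hlt.le
          · exact heq.le
      by_cases hbv : b = v
      · subst hbv
        obtain ⟨k1, k2⟩ := h.home (a := ⟨b, hb⟩) (h.active hK)
        have := hle _ k1
        rw [k2] at this
        exact this.trans (N.dist_nonneg _ _)
      · obtain ⟨w, hw, hwu, hwb⟩ := hs.exists_adj hT hbv
        obtain ⟨c, hc, -, hcu⟩ := h.arrived (h.active hK) (h2.2.2 w hw.symm hwu)
        exact (hle c hc).trans (hcu b hb hwb)
  edge_known := by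
    intro a v u x ha b hs
    rcases h.loc_of_activate_edge ha with ⟨h1, -⟩ | ⟨rfl, -, h1, hK, h2, h3⟩
    · exact subset_activate_known a (h.edge_known h1 b hs)
    · refine h.known_of_node (h.active hK) h1 b ?_
      by_cases hbv : b.1 = v
      · exact Or.inl hbv
      · obtain ⟨w, hw, hwu, hwb⟩ := hs.exists_adj hT hbv
        exact Or.inr ⟨w, h2.2.2 w hw.symm hwu, hwb⟩
  home := by
    intro a hv
    rw [(activate_view a).2]
    obtain ⟨h1, h2⟩ := h.home (a := a) fun u hf => hv u (Or.inl hf)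
    exact ⟨h.activate_of_still hv h1, h2⟩
  arrived := by
    intro v w hv hd
    obtain ⟨a, h1, h2, h3⟩ := h.arrived (fun u hf => hv u (Or.inl hf)) hd
    refine ⟨a, h.activate_of_still hv h1, ?_⟩
    rw [(activate_view a).1, (activate_view a).2]
    exact ⟨h2, h3⟩

/-- The activation of the agents turns the precondition into the invariant. -/
theorem Pre.activate_inv (hT : N.G.IsTree) (hleaf : ∀ v, N.deg v = 1 → v ∈ A)
    (h : Pre N A C F Dn K W) : Inv N A (N.activate greedy W C) (Extend N F Dn K) Dn where
  toCore := h.activate_core hT hleaf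
  node_ahead ha := (h.loc_of_activate_node ha).2
  opposite_lt := by
    intro a b v u x y ha hb h0
    rcases h.loc_of_activate_edge ha with ⟨h1, h2⟩ | ⟨rfl, -, -, -, h3, -⟩
    swap
    · have := ((h.activate_core hT hleaf).edge hb).2.2.2.1
      rw [N.len_comm u v] at this
      linarith
    rcases h.loc_of_activate_edge hb with ⟨k1, k2⟩ | ⟨rfl, -, -, -, -, -⟩
    swap
    · linarith [(h.edge h1).2.2.2.1]
    have hW : a ∉ W := by
      intro haW
      simp [h2, haW] at h0
    rw [h2, if_neg hW] at h0
    exact lt_of_le_of_ne (h.opposite_le h1 k1 h0) fun he => hW (h.mem_opposite h1 k1 h0 he)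
  known := by
    intro a v hv ha b hb
    exact h.known_of_node (fun u hf => hv u (Or.inl hf)) (h.loc_of_activate_node ha).1 b hb
  branch := by
    intro v w hv hw hd
    by_cases hK : K v
    · by_contra! hcon
      refine hv w (Or.inr ⟨hK, hw, hd, fun z hz hzw => ?_⟩)
      exact hcon z hzw hz
    · exact h.branch (fun u hf => hv u (Or.inl hf)) hK hw hd

/-- The precondition holds at time `0`. -/
theorem start_pre (hleaf : ∀ v, N.deg v = 1 → v ∈ A) :
    Pre N A (fun a : A => ⟨.node a.1, 0, ⟨none, 0, greedy.init⟩, {a}⟩) (fun _ _ => False)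
      (fun _ _ => False) (· ∈ A) Set.univ where
  adj := False.elim
  started := id
  anti := False.elim
  pred := False.elim
  owner := False.elim
  edge := by intro a v u x h; cases h
  uniq := by intro a b v u x y h; cases h
  opposite := by intro a b v u x y h; cases h
  stopped := by intro a v u x h; cases h
  stopped_known := by intro a v u x h; cases h
  entry := by intro a v h; cases h; exact Or.inl ⟨rfl, rfl, rfl⟩
  entry_inj := by
    intro a b v ha hb _
    cases ha
    exact Subtype.ext (Loc.node.inj hb).symm
  used_le _ := D_nonneg A
  edge_used := by intro a v u x h; cases h
  edge_known := by intro a v u x h; cases h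
  home _ := ⟨rfl, rfl⟩
  arrived _ := False.elim
  edge_pos := by intro a v u x h; cases h
  active _ _ := id
  mem_node := by
    intro a v h
    cases h
    simp
  mem_edge := by intro a v u x h; cases h
  opposite_le := by intro a b v u x y h; cases h
  mem_opposite := by intro a b v u x y h; cases h
  node_ahead _ _ := rfl
  known := by
    rintro v - b (rfl | ⟨w, hw, -⟩)
    · exact ⟨b, rfl, rfl⟩
    · exact hw.elim
  branch := by
    intro v w _ hK hw _
    -- Before any move, a node lacking only one arrival is a leaf, hence in `A`.
    by_contra! hcon
    refine hK (hleaf v (Set.ncard_eq_one.2 ⟨w, ?_⟩))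
    ext z
    refine ⟨fun hz => ?_, fun hz => by rw [Set.mem_singleton_iff.1 hz]; exact hw⟩
    by_contra hne
    exact hcon z hne hz

/-! ### Motion between two events. -/

variable {δ : ℝ}

/-- Agent `a` is moving on the edge `vu` towards `u` and is at distance `x` from `v`. -/
def Moves (C : Config V A greedy.Memory) (a : A) (v u : V) (x : ℝ) : Prop :=
  (C a).loc = .edge v u x ∧ (C a).ahead ≠ 0

variable (N) in
/-- Agent `a` moves on the edge `vu` and reaches `u` after time `δ`. -/
def Arrives (C : Config V A greedy.Memory) (δ : ℝ) (a : A) (v u : V) : Prop :=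
  ∃ x, Moves C a v u x ∧ x + δ = N.len s(v, u)

variable (N) in
/-- No agent passes a node or meets another agent before time `δ`. -/
structure Free (C : Config V A greedy.Memory) (δ : ℝ) : Prop where
  pos : 0 < δ
  le_len : ∀ {a v u x}, Moves C a v u x → x + δ ≤ N.len s(v, u)
  le_opposite : ∀ {a b v u x y}, Moves C a v u x → Moves C b u v y →
    x + y + 2 * δ ≤ N.len s(v, u)

theorem advance_known (a : A) : (N.advance δ C a).known = (C a).known := by
  unfold advance advanceAgent
  split_ifs
  · rfl
  · cases hl : (C a).loc with
    | node v => simp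
    | edge u v x =>
      simp only
      split_ifs <;> rfl

theorem advance_still {a : A} (h : (C a).ahead = 0) : N.advance δ C a = C a := by
  simp [advance, advanceAgent, h]

theorem Arrives.advance {a : A} {v u : V} (h : Arrives N C δ a v u) :
    (N.advance δ C a).loc = .node u ∧ (N.advance δ C a).view.entry = some (N.port u v) ∧
    (N.advance δ C a).view.used = (C a).view.used + δ := by
  obtain ⟨x, ⟨h1, h2⟩, h3⟩ := h
  simp [Network.advance, advanceAgent, h1, h2, h3]

theorem Inv.advance_move (hI : Inv N A C F Dn) {a : A} {v u : V} {x : ℝ} (h : Moves C a v u x)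
    (hx : x + δ < N.len s(v, u)) :
    (N.advance δ C a).loc = .edge v u (x + δ) ∧ (N.advance δ C a).ahead = ⊤ ∧
    (N.advance δ C a).view.used = (C a).view.used + δ := by
  obtain ⟨h1, h2⟩ := h
  have h3 : (C a).ahead = ⊤ := (hI.edge h1).2.2.2.2.resolve_left h2
  simp [Network.advance, advanceAgent, h1, h3, hx.not_ge]

theorem Inv.advance_cases (hI : Inv N A C F Dn) (hδ : Free N C δ) (a : A) :
    ((C a).ahead = 0 ∧ N.advance δ C a = C a) ∨ (∃ v u, Arrives N C δ a v u) ∨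
    ∃ v u x, Moves C a v u x ∧ x + δ < N.len s(v, u) := by
  by_cases h0 : (C a).ahead = 0
  · exact Or.inl ⟨h0, advance_still h0⟩
  · right
    cases hl : (C a).loc with
    | node v => exact absurd (hI.node_ahead hl) h0
    | edge v u x =>
      rcases (hδ.le_len ⟨hl, h0⟩).eq_or_lt with h | h
      · exact Or.inl ⟨v, u, x, ⟨hl, h0⟩, h⟩
      · exact Or.inr ⟨v, u, x, ⟨hl, h0⟩, h⟩

theorem Inv.advance_node (hI : Inv N A C F Dn) (hδ : Free N C δ) {a : A} {v : V}
    (h : (N.advance δ C a).loc = .node v) :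
    ((C a).ahead = 0 ∧ (C a).loc = .node v ∧ N.advance δ C a = C a) ∨
    ∃ w, Arrives N C δ a w v := by
  rcases hI.advance_cases hδ a with ⟨h1, h2⟩ | ⟨w, u, h1⟩ | ⟨w, u, x, h1, h2⟩
  · exact Or.inl ⟨h1, by rw [← h, h2], h2⟩
  · right
    have := h1.advance.1.symm.trans h
    cases this
    exact ⟨w, h1⟩
  · rw [(hI.advance_move h1 h2).1] at h
    cases h

theorem Inv.advance_edge (hI : Inv N A C F Dn) (hδ : Free N C δ) {a : A} {v u : V} {y : ℝ}
    (h : (N.advance δ C a).loc = .edge v u y) :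
    ((C a).ahead = 0 ∧ (C a).loc = .edge v u y ∧ N.advance δ C a = C a) ∨
    ∃ x, Moves C a v u x ∧ y = x + δ ∧ y < N.len s(v, u) ∧ (N.advance δ C a).ahead = ⊤ ∧
      (N.advance δ C a).view.used = (C a).view.used + δ := by
  rcases hI.advance_cases hδ a with ⟨h1, h2⟩ | ⟨w, u, h1⟩ | ⟨w, u, x, h1, h2⟩
  · exact Or.inl ⟨h1, by rw [← h, h2], h2⟩
  · rw [h1.advance.1] at h
    cases h
  · right
    obtain ⟨h3, h4, h5⟩ := hI.advance_move h1 h2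
    rw [h3] at h
    cases h
    exact ⟨x, h1, rfl, h2, h4, h5⟩

/-- Agents facing each other on an edge stop only together. -/
theorem Inv.moves_opposite (hI : Inv N A C F Dn) {a b : A} {v u : V} {x y : ℝ}
    (ha : Moves C a v u x) (hb : (C b).loc = .edge u v y) : Moves C b u v y :=
  ⟨hb, fun h0 => ha.2 (hI.opposite hb ha.1 h0).1⟩

theorem Inv.advance_interior (hI : Inv N A C F Dn) (hδ : Free N C δ) :
    N.Interior (N.advance δ C) where
  edge := by
    intro a v u y h
    rcases hI.advance_edge hδ h with ⟨h0, h1, -⟩ | ⟨x, h1, rfl, h2, -⟩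
    · exact ⟨hI.adj (hI.edge h1).1, (hI.stopped h1 h0).1, (hI.edge h1).2.2.2.1⟩
    · exact ⟨hI.adj (hI.edge h1.1).1, by linarith [(hI.edge h1.1).2.2.1, hδ.pos], h2⟩
  uniq := by
    intro a b v u x y ha hb
    have key : ∀ {c z}, (N.advance δ C c).loc = .edge v u z → ∃ z', (C c).loc = .edge v u z' := by
      intro c z h
      rcases hI.advance_edge hδ h with ⟨-, h1, -⟩ | ⟨x, h1, -⟩
      · exact ⟨_, h1⟩
      · exact ⟨_, h1.1⟩
    obtain ⟨x', ha'⟩ := key ha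
    obtain ⟨y', hb'⟩ := key hb
    exact hI.uniq ha' hb'

/-- Moving agents have `ahead = ⊤`, so no travel limit expires. A new coincidence at a node needs an
arrival; inside an edge it needs two agents in opposite directions, both moving. -/
theorem Inv.of_happens (hI : Inv N A C F Dn) (hδ : Free N C δ) {a : A} (h : N.Happens C δ a) :
    (∃ b v u, N.Together (N.advance δ C) a b ∧ Arrives N C δ b v u) ∨
    ∃ b v u x y, Moves C a v u x ∧ Moves C b u v y ∧ x + y + 2 * δ = N.len s(v, u) := by
  have hint := hI.advance_interior hδ
  rcases h with ⟨h0, h⟩ | ⟨b, h1, h2⟩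
  · left
    rcases hI.advance_cases hδ a with ⟨h1, h2⟩ | ⟨w, u, h1⟩ | ⟨w, u, x, h1, h2⟩
    · exact absurd h1 h0
    · exact ⟨a, w, u, .refl a, h1⟩
    · obtain ⟨h3, h4, -⟩ := hI.advance_move h1 h2
      rw [h3, h4] at h
      simp at h
  · cases hl : (N.advance δ C a).loc with
    | node v =>
      left
      have hb := (hint.together_node hl).1 h2
      rcases hI.advance_node hδ hl with ⟨-, ha1, -⟩ | ⟨w, ha⟩
      · rcases hI.advance_node hδ hb with ⟨-, hb1, -⟩ | ⟨w, hb'⟩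
        · exact absurd (Together.of_loc_eq (ha1.trans hb1.symm)) h1
        · exact ⟨b, w, v, h2, hb'⟩
      · exact ⟨a, w, v, .refl a, ha⟩
    | edge v u z =>
      rcases hint.together_edge hl h2 with rfl | ⟨y, hb, hy⟩
      · exact absurd (.refl b) h1
      · rcases hI.advance_edge hδ hl with ⟨ha0, ha, hae⟩ | ⟨x, ha, rfl, -⟩
        · rcases hI.advance_edge hδ hb with ⟨hb0, -, hbe⟩ | ⟨y', hb', -⟩
          · unfold Together at h1 h2
            rw [hae, hbe] at h2
            exact absurd h2 h1
          · exact absurd ha0 (hI.moves_opposite hb' ha).2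
        · right
          rcases hI.advance_edge hδ hb with ⟨hb0, hb', -⟩ | ⟨y', hb', rfl, -⟩
          · exact absurd hb0 (hI.moves_opposite ha hb').2
          · exact ⟨b, v, u, x, y', ha, hb', by linarith⟩

theorem Arrives.happens {a : A} {v u : V} (h : Arrives N C δ a v u) : N.Happens C δ a := by
  left
  have := h.advance.1
  obtain ⟨x, h1, -⟩ := h
  exact ⟨h1.2, Or.inl ⟨u, this⟩⟩

theorem Inv.happens_of_opposite (hI : Inv N A C F Dn) (hδ : Free N C δ) {a b : A} {v u : V}
    {x y : ℝ} (ha : Moves C a v u x) (hb : Moves C b u v y)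
    (h : x + y + 2 * δ = N.len s(v, u)) : N.Happens C δ a := by
  right
  have hadj := hI.adj (hI.edge ha.1).1
  have hx := (hI.edge ha.1).2.2.1
  have hy := (hI.edge hb.1).2.2.1
  have hp := hδ.pos
  have hl := N.len_comm u v
  refine ⟨b, ?_, ?_⟩
  · rw [together_opposite hadj ha.1 hb.1]
    linarith
  · rw [together_opposite hadj (hI.advance_move ha (by linarith)).1
      (hI.advance_move hb (by linarith)).1]
    linarith

/-- Leaving `v` towards a node other than `w` requires that the dart `wv` was already traversed. An
agent that left towards `w` either has arrived, which `anti` excludes, or would have been met inside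
the edge. -/
theorem Inv.not_started_of_arrives (hI : Inv N A C F Dn) (hδ : Free N C δ) {a : A} {w v : V}
    (h : Arrives N C δ a w v) (u : V) : ¬ F v u := by
  intro hF
  obtain ⟨x, h1, h2⟩ := h
  obtain ⟨k1, k2, -⟩ := hI.edge h1.1
  by_cases huw : u = w
  · subst huw
    by_cases hd : Dn v u
    · exact hI.anti hd k1
    · obtain ⟨b, y, hb⟩ := hI.owner hF hd
      have := hδ.le_opposite h1 (hI.moves_opposite h1 hb)
      linarith [(hI.edge hb).2.2.1, hδ.pos]
  · exact k2 (hI.pred hF (hI.adj k1).symm (Ne.symm huw))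

/-- Both sides of the edge contain leaves, hence nodes of `A`. A pair across this splitting at
distance at most `D` has the whole edge on its path; the part beyond `u` is dropped. -/
theorem exists_pair_dist_le_D [Finite V] (hT : N.G.IsTree) (hleaf : ∀ v, N.deg v = 1 → v ∈ A)
    {v u : V} (h : N.G.Adj v u) :
    ∃ b ∈ A, Side N.G v u b ∧ N.dist b v + N.len s(v, u) ≤ N.D A := by
  obtain ⟨b, hb, hb1⟩ := exists_leaf_side hT h
  obtain ⟨c, hc, hc1⟩ := exists_leaf_side hT h.symm
  obtain ⟨b, hbA, hb, c, hcA, hc, hd⟩ := exists_dist_le_D (N := N) (A := A)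
    (X := {x | Side N.G v u x}) ⟨b, hleaf b hb1, hb⟩ ⟨c, hleaf c hc1, hc.not_side⟩
  refine ⟨b, hbA, hb, ?_⟩
  have := dist_across hT h hb ((side_or hT h c).resolve_left hc)
  linarith [N.dist_nonneg u c]

variable (N) in
/-- The darts that have been traversed completely after time `δ`. -/
def Traversed (C : Config V A greedy.Memory) (Dn : V → V → Prop) (δ : ℝ) (v u : V) : Prop :=
  Dn v u ∨ ∃ a, Arrives N C δ a v u

theorem Inv.advance_core [Finite V] (hT : N.G.IsTree) (hleaf : ∀ v, N.deg v = 1 → v ∈ A)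
    (hI : Inv N A C F Dn) (hδ : Free N C δ) :
    Core N A (N.advance δ C) F (Traversed N C Dn δ) where
  adj := hI.adj
  started := by
    rintro v u (h | ⟨a, x, h, -⟩)
    · exact hI.started h
    · exact (hI.edge h.1).1
  anti := by
    rintro v u (h | ⟨a, h⟩)
    · exact hI.anti h
    · exact hI.not_started_of_arrives hδ h v
  pred hf hw hwu := Or.inl (hI.pred hf hw hwu)
  owner := by
    intro v u hf hd
    obtain ⟨a, x, ha⟩ := hI.owner hf fun h => hd (Or.inl h)
    by_cases h0 : (C a).ahead = 0
    · exact ⟨a, x, by rw [advance_still h0, ha]⟩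
    · refine ⟨a, x + δ, (hI.advance_move ⟨ha, h0⟩ ?_).1⟩
      exact lt_of_le_of_ne (hδ.le_len ⟨ha, h0⟩) fun he => hd (Or.inr ⟨a, x, ⟨ha, h0⟩, he⟩)
  edge := by
    intro a v u y ha
    have hnA : ∀ {z}, (C a).loc = .edge v u z → ¬ ∃ b, Arrives N C δ b v u := by
      rintro z hz ⟨b, hb⟩
      have hb2 := hb
      obtain ⟨x, h1, h2⟩ := hb
      obtain rfl := hI.uniq h1.1 hz
      rw [hb2.advance.1] at ha
      cases ha
    obtain ⟨-, k2, k3⟩ := (hI.advance_interior hδ).edge ha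
    rcases hI.advance_edge hδ ha with ⟨h0, h1, h2⟩ | ⟨x, h1, -, -, h2, -⟩
    · obtain ⟨l1, l2, -⟩ := hI.edge h1
      exact ⟨l1, not_or.2 ⟨l2, hnA h1⟩, k2.le, k3, Or.inl (by rw [h2, h0])⟩
    · obtain ⟨l1, l2, -⟩ := hI.edge h1.1
      exact ⟨l1, not_or.2 ⟨l2, hnA h1.1⟩, k2.le, k3, Or.inr h2⟩
  uniq := (hI.advance_interior hδ).uniq
  opposite := by
    intro a b v u x y ha hb h0
    rcases hI.advance_edge hδ ha with ⟨-, h1, h2⟩ | ⟨x', -, -, -, h2, -⟩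
    · rw [h2] at h0
      rcases hI.advance_edge hδ hb with ⟨-, k1, k2⟩ | ⟨y', k1, -⟩
      · rw [k2]
        exact hI.opposite h1 k1 h0
      · exact absurd h0 (hI.moves_opposite k1 h1).2
    · rw [h2] at h0
      exact absurd h0 (by simp)
  stopped := by
    intro a v u x ha h0
    rcases hI.advance_edge hδ ha with ⟨-, h1, h2⟩ | ⟨x', -, -, -, h2, -⟩
    · rw [h2] at h0
      exact hI.stopped h1 h0
    · rw [h2] at h0
      exact absurd h0 (by simp)
  stopped_known := by
    intro a v u x ha h0
    rw [advance_known]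
    rcases hI.advance_edge hδ ha with ⟨-, h1, h2⟩ | ⟨x', -, -, -, h2, -⟩
    · rw [h2] at h0
      exact hI.stopped_known h1 h0
    · rw [h2] at h0
      exact absurd h0 (by simp)
  entry := by
    intro a v ha
    rcases hI.advance_node hδ ha with ⟨-, h1, h2⟩ | ⟨w, h1⟩
    · rw [h2]
      rcases hI.entry h1 with h | ⟨w, h3, h4, h5⟩
      · exact Or.inl h
      · exact Or.inr ⟨w, h3, Or.inl h4, h5⟩
    · have h2 := h1
      obtain ⟨x, h3, -⟩ := h2
      exact Or.inr ⟨w, (hI.adj (hI.edge h3.1).1).symm, Or.inr ⟨a, h1⟩, h1.advance.2.1⟩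
  entry_inj := by
    -- The port of an arriving agent is new at the node, because its dart had not been traversed.
    have key : ∀ {a b v w}, Arrives N C δ a w v → (C b).loc = .node v →
        (C b).view.entry ≠ some (N.port v w) := by
      rintro a b v w ⟨x, h1, -⟩ hb he
      obtain ⟨k1, k2, -⟩ := hI.edge h1.1
      rcases hI.entry hb with ⟨h, -⟩ | ⟨w', l1, l2, l3⟩
      · rw [h] at he
        cases he
      · rw [l3] at he
        obtain rfl := port_inj l1 (hI.adj k1).symm (Option.some.inj he)
        exact k2 l2
    intro a b v ha hb he
    rcases hI.advance_node hδ ha with ⟨-, h1, h2⟩ | ⟨w, h1⟩ <;>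
    rcases hI.advance_node hδ hb with ⟨-, k1, k2⟩ | ⟨w', k1⟩
    · rw [h2, k2] at he
      exact hI.entry_inj h1 k1 he
    · rw [h2, k1.advance.2.1] at he
      exact absurd he (key k1 h1)
    · rw [k2, h1.advance.2.1] at he
      exact absurd he.symm (key h1 k1)
    · rw [h1.advance.2.1, k1.advance.2.1] at he
      obtain ⟨x, h3, -⟩ := h1
      obtain ⟨y, k3, -⟩ := k1
      obtain rfl := port_inj (hI.adj (hI.edge h3.1).1).symm (hI.adj (hI.edge k3.1).1).symm
        (Option.some.inj he)
      exact hI.uniq h3.1 k3.1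
  used_le a := by
    have key : ∀ {v u x}, Moves C a v u x → (C a).view.used + δ ≤ N.D A := by
      intro v u x h
      obtain ⟨b, hb, hs, hd⟩ := exists_pair_dist_le_D hT hleaf (hI.adj (hI.edge h.1).1)
      linarith [hI.edge_used h.1 b hb hs, hδ.le_len h]
    rcases hI.advance_cases hδ a with ⟨h1, h2⟩ | ⟨w, u, h1⟩ | ⟨w, u, x, h1, h2⟩
    · rw [h2]
      exact hI.used_le a
    · rw [h1.advance.2.2]
      obtain ⟨x, h1, -⟩ := h1
      exact key h1
    · rw [(hI.advance_move h1 h2).2.2]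
      exact key h1
  edge_used := by
    intro a v u y ha b hb hs
    rcases hI.advance_edge hδ ha with ⟨-, h1, h2⟩ | ⟨x, h1, rfl, -, -, h2⟩
    · rw [h2]
      exact hI.edge_used h1 b hb hs
    · rw [h2]
      linarith [hI.edge_used h1.1 b hb hs]
  edge_known := by
    intro a v u y ha
    rw [advance_known]
    rcases hI.advance_edge hδ ha with ⟨-, h1, -⟩ | ⟨x, h1, -⟩
    · exact hI.edge_known h1
    · exact hI.edge_known h1.1
  home := by
    intro a hv
    rw [advance_still (hI.node_ahead (hI.home hv).1)]
    exact hI.home hv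
  arrived := by
    rintro v w hv (hd | ⟨a, h⟩)
    · obtain ⟨a, ha, h⟩ := hI.arrived hv hd
      refine ⟨a, ?_⟩
      rw [advance_still (hI.node_ahead ha)]
      exact ⟨ha, h⟩
    · refine ⟨a, h.advance.1, h.advance.2.1, fun b hb hs => ?_⟩
      rw [h.advance.2.2]
      obtain ⟨x, h1, h2⟩ := h
      have hadj := hI.adj (hI.edge h1.1).1
      -- Taking `v` itself as the second point gives `dist b w + len ≤ dist b v`.
      have := dist_across hT hadj hs (side_self hadj.symm)
      rw [N.dist_self] at this
      linarith [hI.edge_used h1.1 b hb hs]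

theorem Inv.advance_pre [Finite V] (hT : N.G.IsTree) (hleaf : ∀ v, N.deg v = 1 → v ∈ A)
    (hI : Inv N A C F Dn) (hδ : Free N C δ) :
    Pre N A (N.advance δ C) F (Traversed N C Dn δ) (fun v => ∃ a w, Arrives N C δ a w v)
      {a | ∃ b, N.Together (N.advance δ C) a b ∧ N.Happens C δ b} where
  toCore := hI.advance_core hT hleaf hδ
  edge_pos ha := ((hI.advance_interior hδ).edge ha).2.1
  active := by
    rintro v ⟨a, w, h⟩
    exact hI.not_started_of_arrives hδ h
  mem_node := by
    intro a v ha
    have hint := hI.advance_interior hδ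
    constructor
    · rintro ⟨b, hb, hh⟩
      rcases hI.of_happens hδ hh with ⟨c, w, u, hc, hA⟩ | ⟨c, w, u, x, y, h1, h2, h3⟩
      · have := (hint.together_node ha).1 (Eq.trans hb hc)
        rw [hA.advance.1] at this
        cases this
        exact ⟨c, w, hA⟩
      · have := (hint.together_node ha).1 hb
        rw [(hI.advance_move h1 (by linarith [(hI.edge h2.1).2.2.1, hδ.pos])).1] at this
        cases this
    · rintro ⟨b, w, hb⟩
      exact ⟨b, (hint.together_node ha).2 hb.advance.1, hb.happens⟩
  mem_edge := by
    rintro a v u x ha ⟨b, hb, hh⟩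
    have hint := hI.advance_interior hδ
    rcases hint.together_edge ha hb with rfl | ⟨y, hb, hy⟩
    · rcases hI.of_happens hδ hh with ⟨c, w, u', hc, hA⟩ | ⟨c, w, u', z, y, h1, h2, h3⟩
      · have := (hint.together_node hA.advance.1).1 hc.symm
        rw [ha] at this
        cases this
      · have hl := N.len_comm u' w
        have hz := (hI.edge h1.1).2.2.1
        have hy := (hI.edge h2.1).2.2.1
        have hp := hδ.pos
        have := (hI.advance_move (δ := δ) h1 (by linarith)).1
        rw [ha] at this
        cases this
        exact ⟨c, _, (hI.advance_move h2 (by linarith)).1, by linarith⟩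
    · exact ⟨b, y, hb, hy⟩
  opposite_le := by
    intro a b v u x y ha hb h0
    rcases hI.advance_edge hδ ha with ⟨h1, -, h2⟩ | ⟨x', h1, rfl, -⟩
    · exact absurd (by rw [h2, h1]) h0
    · rcases hI.advance_edge hδ hb with ⟨k0, k1, -⟩ | ⟨y', k1, rfl, -⟩
      · exact absurd k0 (hI.moves_opposite h1 k1).2
      · linarith [hδ.le_opposite h1 k1]
  mem_opposite := by
    intro a b v u x y ha hb h0 hxy
    rcases hI.advance_edge hδ ha with ⟨h1, -, h2⟩ | ⟨x', h1, rfl, -⟩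
    · exact absurd (by rw [h2, h1]) h0
    · rcases hI.advance_edge hδ hb with ⟨k0, k1, -⟩ | ⟨y', k1, rfl, -⟩
      · exact absurd k0 (hI.moves_opposite h1 k1).2
      · exact ⟨a, .refl a, hI.happens_of_opposite hδ h1 k1 (by linarith)⟩
  node_ahead := by
    intro a v ha hK
    rcases hI.advance_node hδ ha with ⟨h1, -, h2⟩ | ⟨w, h⟩
    · rw [h2, h1]
    · exact absurd ⟨a, w, h⟩ hK
  known := by
    have key : ∀ {v}, (∀ u, ¬ F v u) → ∀ {b : A},
        (b.1 = v ∨ ∃ w, Dn w v ∧ Side N.G w v b) → ∀ {a}, (C a).loc = .node v →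
        ∃ a, (N.advance δ C a).loc = .node v ∧ b ∈ (N.advance δ C a).known := by
      intro v hv b hb a ha
      refine ⟨a, ?_⟩
      rw [advance_still (hI.node_ahead ha)]
      exact ⟨ha, hI.known hv ha b hb⟩
    rintro v hv b (rfl | ⟨w, hd | ⟨a, h⟩, hs⟩)
    · exact key hv (Or.inl rfl) (hI.home hv).1
    · obtain ⟨a, ha, -⟩ := hI.arrived hv hd
      exact key hv (Or.inr ⟨w, hd, hs⟩) ha
    · refine ⟨a, h.advance.1, ?_⟩
      rw [advance_known]
      obtain ⟨x, h1, -⟩ := h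
      exact hI.edge_known h1.1 b hs
  branch := by
    intro v w hv hK hw hd
    obtain ⟨z, h1, h2, h3⟩ := hI.branch hv hw fun h => hd (Or.inl h)
    exact ⟨z, h1, h2, not_or.2 ⟨h3, fun ⟨a, h⟩ => hK ⟨a, z, h⟩⟩⟩

/-! ### Termination and the final configuration. -/

/-- The first event, if some agent is moving. -/
theorem Inv.exists_isLeast (hI : Inv N A C F Dn) {a : A} (ha : (C a).ahead ≠ 0) :
    ∃ δ, Free N C δ ∧ IsLeast (N.eventTimes C) δ ∧
      ((∃ a v u, Arrives N C δ a v u) ∨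
      ∃ a b v u x y, Moves C a v u x ∧ Moves C b u v y ∧ x + y + 2 * δ = N.len s(v, u)) := by
  -- Candidate times: each moving agent determines at most one arrival and each opposite pair at
  -- most one meeting, so there is a first one.
  let T : Set ℝ := {d | (∃ a v u, Arrives N C d a v u) ∨
    ∃ a b v u x y, Moves C a v u x ∧ Moves C b u v y ∧ x + y + 2 * d = N.len s(v, u)}
  let rest : A → ℝ := fun a => match (C a).loc with
    | .node _ => 0
    | .edge v u x => N.len s(v, u) - x
  let off : A → ℝ := fun a => match (C a).loc with
    | .node _ => 0
    | .edge _ _ x => x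
  have hfin : T.Finite := by
    refine ((Set.finite_range rest).union
      (Set.finite_range fun q : A × A => (rest q.1 - off q.2) / 2)).subset ?_
    rintro d (⟨a, v, u, x, h, hd⟩ | ⟨a, b, v, u, x, y, h1, h2, hd⟩)
    · left
      refine ⟨a, ?_⟩
      simp only [rest, h.1]
      linarith
    · right
      refine ⟨(a, b), ?_⟩
      simp only [rest, off, h1.1, h2.1]
      linarith
  have hne : T.Nonempty := by
    cases hl : (C a).loc with
    | node v => exact absurd (hI.node_ahead hl) ha
    | edge v u x => exact ⟨N.len s(v, u) - x, Or.inl ⟨a, v, u, x, ⟨hl, ha⟩, by ring⟩⟩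
  obtain ⟨δ, hδT, hmin⟩ := Set.exists_min_image T id hfin hne
  have hpos : 0 < δ := by
    rcases hδT with ⟨a, v, u, x, h, hd⟩ | ⟨a, b, v, u, x, y, h1, h2, hd⟩
    · linarith [(hI.edge h.1).2.2.2.1]
    · linarith [hI.opposite_lt h1.1 h2.1 h1.2]
  have hfree : Free N C δ := by
    refine ⟨hpos, fun {a v u x} h => ?_, fun {a b v u x y} h1 h2 => ?_⟩
    · have := hmin (N.len s(v, u) - x) (Or.inl ⟨a, v, u, x, h, by ring⟩)
      simp only [id] at this
      linarith
    · have := hmin ((N.len s(v, u) - x - y) / 2) (Or.inr ⟨a, b, v, u, x, y, h1, h2, by ring⟩)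
      simp only [id] at this
      linarith
  refine ⟨δ, hfree, ⟨⟨hpos, ?_⟩, ?_⟩, hδT⟩
  · rcases hδT with ⟨a, v, u, h⟩ | ⟨a, b, v, u, x, y, h1, h2, hd⟩
    · exact ⟨a, h.happens⟩
    · exact ⟨a, hI.happens_of_opposite hfree h1 h2 hd⟩
  -- An earlier event would occur while `Free` still holds, so `of_happens` would make it a smaller
  -- candidate.
  · rintro d ⟨hd, a, hh⟩
    by_contra! hlt
    have hfd : Free N C d := ⟨hd, fun h => by linarith [hfree.le_len h],
      fun h1 h2 => by linarith [hfree.le_opposite h1 h2]⟩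
    rcases hI.of_happens hfd hh with ⟨b, v, u, -, h⟩ | ⟨b, v, u, x, y, h⟩
    · exact absurd (hmin d (Or.inl ⟨b, v, u, h⟩)) (not_le.2 hlt)
    · exact absurd (hmin d (Or.inr ⟨a, b, v, u, x, y, h⟩)) (not_le.2 hlt)

/-- The darts that have been traversed and the agents that have stopped inside an edge. -/
def progress (C : Config V A greedy.Memory) (Dn : V → V → Prop) : Set (A ⊕ V × V) :=
  {q | match q with
    | .inl a => (∃ v u x, (C a).loc = .edge v u x) ∧ (C a).ahead = 0
    | .inr q => Dn q.1 q.2}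

/-- An arrival adds a dart to `progress`, a meeting inside an edge adds stopped agents, and stopped
agents there never move again. -/
theorem Inv.step [Finite V] (hT : N.G.IsTree) (hleaf : ∀ v, N.deg v = 1 → v ∈ A)
    (hI : Inv N A C F Dn) {a : A} (ha : (C a).ahead ≠ 0) :
    ∃ F' Dn', Inv N A (N.step greedy C) F' Dn' ∧
      progress C Dn ⊂ progress (N.step greedy C) Dn' := by
  obtain ⟨δ, hδ, hleast, hev⟩ := hI.exists_isLeast ha
  have hpre := hI.advance_pre hT hleaf hδ
  have hstep : N.step greedy C = N.activate greedy
      {a | ∃ b, N.Together (N.advance δ C) a b ∧ N.Happens C δ b} (N.advance δ C) := by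
    unfold Network.step
    rw [if_pos ⟨δ, hleast.1⟩]
    simp only [hleast.csInf_eq]
  refine ⟨_, _, hstep ▸ hpre.activate_inv hT hleaf, ?_⟩
  rw [hstep]
  constructor
  · rintro (b | ⟨v, u⟩)
    · rintro ⟨⟨v, u, x, h1⟩, h2⟩
      have hb : (N.advance δ C b).loc = .edge v u x := by rw [advance_still h2, h1]
      obtain ⟨h3, h4⟩ := activate_edge (N := N)
        (W := {a | ∃ b, N.Together (N.advance δ C) a b ∧ N.Happens C δ b}) hb
      refine ⟨⟨v, u, x, h3⟩, ?_⟩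
      rw [h4, advance_still h2, h2, ite_self]
    · exact fun h => Or.inl h
  · intro hsub
    rcases hev with ⟨b, v, u, h⟩ | ⟨b, c, v, u, x, y, h1, h2, h3⟩
    · have hd : Dn v u := hsub (a := .inr (v, u)) (Or.inr ⟨b, h⟩)
      obtain ⟨x, h, -⟩ := h
      exact (hI.edge h.1).2.1 hd
    · have hb := (hI.advance_move (δ := δ) h1 (by linarith [(hI.edge h2.1).2.2.1, hδ.pos])).1
      obtain ⟨k1, k2⟩ := activate_edge (N := N)
        (W := {a | ∃ b, N.Together (N.advance δ C) a b ∧ N.Happens C δ b}) hb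
      rw [if_pos ⟨b, .refl b, hI.happens_of_opposite hδ h1 h2 h3⟩] at k2
      exact h1.2 (hsub (a := .inl b) ⟨⟨_, _, _, k1⟩, k2⟩).2

theorem Inv.exists_iterate [Finite V] (hT : N.G.IsTree) (hleaf : ∀ v, N.deg v = 1 → v ∈ A)
    (hI : Inv N A C F Dn) : ∃ n F' Dn', Inv N A ((N.step greedy)^[n] C) F' Dn' ∧
      ∀ a, ((N.step greedy)^[n] C a).ahead = 0 := by
  generalize hs : progress C Dn = s
  induction s using WellFoundedGT.induction generalizing C F Dn with
  | ind s ih =>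
    by_cases h : ∀ a, (C a).ahead = 0
    · exact ⟨0, F, Dn, hI, h⟩
    · push Not at h
      obtain ⟨a, ha⟩ := h
      obtain ⟨F', Dn', hI', hlt⟩ := hI.step hT hleaf ha
      obtain ⟨n, F'', Dn'', h1, h2⟩ := ih _ (hs ▸ hlt) hI' rfl
      exact ⟨n + 1, F'', Dn'', h1, h2⟩

/-- When all agents have stopped, one of them knows everything. -/
theorem Inv.exists_known [Finite V] (hT : N.G.IsTree) (hA : A.Nonempty)
    (hI : Inv N A C F Dn) (h0 : ∀ a, (C a).ahead = 0) : ∃ a, ∀ b, b ∈ (C a).known := by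
  by_cases hE : ∃ a v u x, (C a).loc = .edge v u x
  · obtain ⟨a, v, u, x, ha⟩ := hE
    exact ⟨a, hI.stopped_known ha (h0 a)⟩
  have hFD : ∀ {v u}, F v u → Dn v u := by
    intro v u hf
    by_contra hd
    obtain ⟨a, x, ha⟩ := hI.owner hf hd
    exact hE ⟨a, v, u, x, ha⟩
  obtain ⟨r, hr⟩ := hA
  -- Otherwise every node is left. A traversed dart is never answered by its reverse, so the
  -- departures would form an endless walk without turning back.
  have hactive : ∃ v, ∀ u, ¬ F v u := by
    by_contra! hcon
    obtain ⟨s, hs⟩ := hcon r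
    refine no_infinite_path hT F (fun v w h => hI.adj h) (fun v w h => ?_) r s hs
    obtain ⟨z, hz⟩ := hcon w
    refine ⟨z, ?_, hz⟩
    rintro rfl
    exact hI.anti (hFD h) hz
  obtain ⟨v, hv⟩ := hactive
  -- A missing arrival would propagate forever: if nobody came from `y` to the unleft node `x`, then
  -- `y` is unleft too, since leaving it elsewhere needs an arrival from `x`. By `branch`, `y` then
  -- lacks another neighbour.
  have hall : ∀ w, N.G.Adj v w → Dn w v := by
    intro w hw
    by_contra hd
    refine no_infinite_path hT (fun x y => N.G.Adj x y ∧ (∀ u, ¬ F x u) ∧ ¬ Dn y x)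
      (fun x y h => h.1) ?_ v w ⟨hw, hv, hd⟩
    rintro x y ⟨hxy, hx, hd⟩
    have hy : ∀ u, ¬ F y u := by
      intro u hu
      by_cases hux : u = x
      · subst hux
        exact hd (hFD hu)
      · exact hx y (hI.started (hI.pred hu hxy.symm (Ne.symm hux)))
    obtain ⟨z, h1, h2, h3⟩ := hI.branch hy hxy.symm fun h => hx y (hI.started h)
    exact ⟨z, h1, h2, hy, h3⟩
  have hknown : ∀ {a}, (C a).loc = .node v → ∀ b, b ∈ (C a).known := by
    intro a ha b
    refine hI.known hv ha b ?_
    by_cases hbv : b.1 = v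
    · exact Or.inl hbv
    · obtain ⟨w, hw, hs⟩ := exists_adj_closer hT hbv
      exact Or.inr ⟨w, hall w hw.symm, hs⟩
  by_cases hrv : r = v
  · subst hrv
    exact ⟨⟨r, hr⟩, hknown (hI.home (a := ⟨r, hr⟩) hv).1⟩
  · obtain ⟨w, hw, -⟩ := exists_adj_closer hT hrv
    obtain ⟨a, ha, -⟩ := hI.arrived hv (hall w hw.symm)
    exact ⟨a, hknown ha⟩

end Network

end Convergecast

end

theorem theorem5 :
    ∃ alg : Convergecast.Algorithm,
      ∀ (V : Type*) [Finite V] (N : Convergecast.Network V) (A : Finset V),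
        N.G.IsTree → A.Nonempty → (∀ v, N.deg v = 1 → v ∈ A) →
        ∃ n : ℕ,
          (∀ a, (N.run alg A n a).ahead = 0) ∧
          (∃ a, ∀ b, b ∈ (N.run alg A n a).known) ∧
          (∀ a, (N.run alg A n a).view.used ≤ N.D A) ∧
          (∀ a, ENNReal.ofReal (N.run alg A n a).view.used ≤ 2 * N.optimalPower A) := by
  refine ⟨Convergecast.greedy, fun V _ N A hT hA hleaf => ?_⟩
  obtain ⟨n, F, Dn, hI, h0⟩ :=
    ((Convergecast.Network.start_pre (N := N) hleaf).activate_inv hT hleaf).exists_iterate hT hleaf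
  exact ⟨n, h0, hI.exists_known hT hA h0, hI.used_le, fun a =>
    (ENNReal.ofReal_le_ofReal (hI.used_le a)).trans
      (Convergecast.Network.ofReal_D_le hT.connected hA)⟩
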